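/- Let $p\ge 2$, $m\ge 1$, $\sigma_0>0$, $\theta_1,\theta_2>1$, $L_p\ge 3$, $\kappa_{high}\ge 0$, $\kappa_p\in\mathbb{R}$. Let $n\ge1$ and let $f:\mathbb{R}^n\to\mathbb{R}$ satisfy: (1) $f$ is $p$ times continuously differentiable; (2) $f(x)\ge f_{\rm low}$ for all $x$; (3) $\|\nabla^p f(x)-\nabla^p f(y)\|\le L_p\|x-y\|$ for all $x,y$; (4) $\nabla^i f(x)[d]^i\ge-\kappa_{high}$ for all $x$, all $\|d\|\le 1$ and all $3\le i\le p-1$; (5) if $p\ge3$, $\|\nabla^p f(x)\|\le\kappa_p$ for all $x$. (Vectors carry the Euclidean norm and tensors the norm $\max_{\|v_i\|=1}|T[v_1,\dots,v_r]|$.) Algorithm ARpapprox-FD starts at $x_0$ with $\sigma_0$ and the convention $\|s_j\|=1$ for $j<0$. At iteration $k\ge 0$ it evaluates $\{\nabla^i f(x_k)\}_{i=1}^{p-1}$. If $m\mid k$ it sets $$h_k=\frac{\min\left(\sum_{i=1}^m\|s_{k-i}\|,\,1\right)}{\sqrt n},\qquad A_k=\sum_{i=1}^n\frac{\nabla^{p-1}f(x_k+h_ke_i)-\nabla^{p-1}f(x_k)}{h_k}\otimes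 e_i,\qquad T_k=P_{sym}(A_k),$$ where $P_{sym}$ averages a tensor over all permutations of its arguments; otherwise $T_k=T_{k-1}$. With $$\overline{T}_k(s)=f(x_k)+\sum_{i=1}^{p-1}\tfrac1{i!}\nabla^if(x_k)[s]^i+\tfrac1{p!}T_k[s]^p,\qquad m_k(s)=\overline{T}_k(s)+\tfrac{\sigma_k}{(p+1)!}\|s\|^{p+1},$$ it takes any step $s_k$ such that $$m_k(s_k)\le m_k(0),\qquad \|\nabla\overline{T}_k(s_k)\|\le\frac{\theta_1\sigma_k\|s_k\|^p}{p!},\qquad \max[0,-\lambda_{\min}(\nabla^2\overline{T}_k(s_k))]\le\frac{\theta_2\sigma_k\|s_k\|^{p-1}}{(p-1)!},$$ and sets $x_{k+1}=x_k+s_k$, $\sigma_{k+1}=\sigma_k+\sigma_k\|s_k\|^{p+1}$. It is understood that $h_k>0$ at every iteration $k$ with $m\mid k$ for which $x_k$ is not already an exact second-order critical point ($\nabla f(x_k)=0$, $\nabla^2 f(x_k)\succeq0$), so that the difference quotients make sense. Then there is a constant $C>0$, depending only on $p,m,\sigma_0,\theta_1,\theta_2,L_p,\kappa_{high},\kappa_p$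 and on upper bounds for $f(x_0)-f_{\rm low}$, $\|\nabla f(x_0)\|$ and $\max[0,-\lambda_{\min}(\nabla^2f(x_0))]$ (in particular not on $n$, $\epsilon_1$, $\epsilon_2$), such that for all $\epsilon_1,\epsilon_2\in(0,1]$, with $R=\max\left[\epsilon_1^{-(p+1)/p},\,\epsilon_2^{-(p+1)/(p-1)}\right]$, every run of at least $C R$ iterations produces, after some number $j\le C R$ of iterations, a point $x_\epsilon=x_j$ with $$\|\nabla f(x_\epsilon)\|\le\epsilon_1\quad\text{and}\quad\lambda_{\min}(\nabla^2 f(x_\epsilon))\ge-\epsilon_2,$$ and the number of points at which derivatives $\{\nabla^i f\}_{i=1}^{p-1}$ have been evaluated in iterations $0,\dots,j$ is at most $C\,n\,R$. -/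

import Mathlib

open scoped BigOperators Nat

namespace ARpFD

noncomputable section

/-- `ℝⁿ` with the Euclidean norm. -/
abbrev E (n : ℕ) : Type := EuclideanSpace ℝ (Fin n)

/-- The `i`-th vector of the canonical basis. -/
def e {n : ℕ} (i : Fin n) : E n := EuclideanSpace.single i 1

/-- Multilinear forms of order `r` on `ℝⁿ`; the norm is `max_{‖vᵢ‖ = 1} |T[v₁, …, v_r]|`. -/
abbrev Tensor (n r : ℕ) : Type := ContinuousMultilinearMap ℝ (fun _ : Fin r => E n) ℝ

/-! ### Tensors -/

/-- `M ⊗ eᵢ`, that is `(v₁, …, v_{q+1}) ↦ M[v₁, …, v_q] * ⟨eᵢ, v_{q+1}⟩`. -/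
def tensorBasis {n q : ℕ} (M : Tensor n q) (i : Fin n) : Tensor n (q + 1) :=
  ((ContinuousLinearMap.toSpanSingleton ℝ
      (EuclideanSpace.proj i : E n →L[ℝ] ℝ)).compContinuousMultilinearMap M).uncurryRight

theorem tensorBasis_apply {n q : ℕ} (M : Tensor n q) (i : Fin n) (v : Fin (q + 1) → E n) :
    tensorBasis M i v = M (fun j => v j.castSucc) * (v (Fin.last q)) i := by
  simp [tensorBasis, Fin.init_def]

/-- The projection `P_sym(T) = (1 / r!) ∑_τ τ(T)`, `τ(T)[v₁, …, v_r] = T[v_{τ 1}, …, v_{τ r}]`. -/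
def symmetrize {n r : ℕ} (T : Tensor n r) : Tensor n r :=
  (1 / (r ! : ℝ)) • ∑ τ : Equiv.Perm (Fin r), T.domDomCongr τ

/-! ### Curvature -/

/-- The Hessian matrix of `g` at `x`. -/
def hessian {n : ℕ} (g : E n → ℝ) (x : E n) : Matrix (Fin n) (Fin n) ℝ :=
  Matrix.of fun i j => iteratedFDeriv ℝ 2 g x ![e i, e j]

/-- The leftmost eigenvalue of a (symmetric) matrix. -/
def lambdaMin {n : ℕ} (A : Matrix (Fin n) (Fin n) ℝ) : ℝ := sInf (spectrum ℝ A)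

/-- `x` is an `(ε₁, ε₂)` second-order stationary point of `f`. -/
def SecondOrderStationary {n : ℕ} (f : E n → ℝ) (ε₁ ε₂ : ℝ) (x : E n) : Prop :=
  ‖gradient f x‖ ≤ ε₁ ∧ -ε₂ ≤ lambdaMin (hessian f x)

/-! ### Assumptions on the objective -/

/-- The assumptions on `f`: smoothness, lower bound, Lipschitz `p`-th derivative, one-sided bounds
on the derivatives of order `3, …, p - 1`, and (only if `p ≥ 3`) a bounded `p`-th derivative. -/
structure ProblemAssumptions {n : ℕ} (p : ℕ) (f : E n → ℝ) (flow L κhigh κp : ℝ) : Prop where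
  contDiff : ContDiff ℝ p f
  lower_bound : ∀ x, flow ≤ f x
  lipschitz : ∀ x y, ‖iteratedFDeriv ℝ p f x - iteratedFDeriv ℝ p f y‖ ≤ L * ‖x - y‖
  intermediate : ∀ i : ℕ, 3 ≤ i → i ≤ p - 1 → ∀ x d : E n, ‖d‖ ≤ 1 →
    -κhigh ≤ iteratedFDeriv ℝ i f x (fun _ => d)
  top_bounded : 3 ≤ p → ∀ x, ‖iteratedFDeriv ℝ p f x‖ ≤ κp

/-! ### Programs that call an oracle -/

/-- A computation that may query an oracle `Q → A` and returns a value in `α`. -/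
inductive OracleProg (Q A α : Type) : Type
  | ret (a : α) : OracleProg Q A α
  | query (q : Q) (next : A → OracleProg Q A α) : OracleProg Q A α

namespace OracleProg

variable {Q A α : Type}

/-- The value returned when the queries are answered by `O`. -/
def result (O : Q → A) : OracleProg Q A α → α
  | ret a => a
  | query q next => result O (next (O q))

/-- The number of queries made when they are answered by `O`. -/
def calls (O : Q → A) : OracleProg Q A α → ℕ
  | ret _ => 0
  | query q next => calls O (next (O q)) + 1

/-- Query the points `q 0, …, q (r - 1)` one after the other and continue with the answers. -/
def queryAll : (r : ℕ) → (Fin r → Q) → ((Fin r → A) → OracleProg Q A α) → OracleProg Q A α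
  | 0, _, cont => cont Fin.elim0
  | r + 1, q, cont =>
      query (q 0) fun a => queryAll r (fun i => q i.succ) fun v => cont (Fin.cons a v)

end OracleProg

/-! ### The algorithm -/

/-- An answer of the derivative oracle: one tensor of each order. -/
abbrev Jet (n : ℕ) : Type := (i : ℕ) → Tensor n i

/-- The derivative oracle: one call at `x` returns `∇ⁱf(x)` for `1 ≤ i ≤ p - 1`, and nothing about
the other orders. -/
def derivOracle {n : ℕ} (p : ℕ) (f : E n → ℝ) (x : E n) : Jet n := fun i =>
  if 1 ≤ i ∧ i ≤ p - 1 then iteratedFDeriv ℝ i f x else 0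

/-- The step lengths `‖s_j‖`, with `‖s_j‖ = 1` for negative `j`. -/
def stepNorm {n : ℕ} (s : ℕ → E n) (j : ℤ) : ℝ := if 0 ≤ j then ‖s j.toNat‖ else 1

/-- The discretization step `h_k = min(∑_{i=1}^m ‖s_{k-i}‖, 1) / √n`. -/
def fdStep {n : ℕ} (m : ℕ) (s : ℕ → E n) (k : ℕ) : ℝ :=
  min (∑ i ∈ Finset.Icc 1 m, stepNorm s ((k : ℤ) - (i : ℤ))) 1 / Real.sqrt n

/-- The finite-difference tensor `∑ᵢ ((∇^{p-1}f(x + h eᵢ) - ∇^{p-1}f(x)) / h) ⊗ eᵢ`, from the oracle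
answers `J` at `x` and `D i` at `x + h eᵢ`. (Order `p = 0` is irrelevant.) -/
def fdTensor {n : ℕ} (h : ℝ) (J : Jet n) (D : Fin n → Jet n) : (p : ℕ) → Tensor n p
  | 0 => 0
  | q + 1 => ∑ i, tensorBasis (h⁻¹ • (D i q - J q)) i

/-- The derivative evaluations of iteration `k`, at the point `x` and with discretization step `h`:
the derivatives at `x` are computed and, if `m ∣ k`, the tensor is refreshed by symmetrized finite
differences; otherwise the previous tensor `Tprev` is kept. Returns the derivatives at `x` and the
new tensor. -/
def iteration {n : ℕ} (p m k : ℕ) (x : E n) (h : ℝ) (Tprev : Tensor n p) :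
    OracleProg (E n) (Jet n) (Jet n × Tensor n p) :=
  .query x fun J =>
    if k % m = 0 then
      OracleProg.queryAll n (fun i => x + h • e i) fun D =>
        .ret (J, symmetrize (fdTensor h J D p))
    else .ret (J, Tprev)

/-- The inexact Taylor polynomial `f₀ + ∑_{i=1}^{p-1} (1/i!) J_i[s]^i + (1/p!) T[s]^p`. -/
def approxTaylor {n p : ℕ} (f₀ : ℝ) (J : Jet n) (T : Tensor n p) (s : E n) : ℝ :=
  f₀ + ∑ i ∈ Finset.Icc 1 (p - 1), (1 / (i ! : ℝ)) * J i (fun _ => s)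
    + (1 / (p ! : ℝ)) * T (fun _ => s)

/-- The regularized model. -/
def model {n p : ℕ} (f₀ : ℝ) (J : Jet n) (T : Tensor n p) (σ : ℝ) (s : E n) : ℝ :=
  approxTaylor f₀ J T s + σ / ((p + 1)! : ℝ) * ‖s‖ ^ (p + 1)

/-- The three tests on the step `s`. They do not depend on the value of the constant `f₀`. -/
structure StepAccepted {n p : ℕ} (θ₁ θ₂ f₀ : ℝ) (J : Jet n) (T : Tensor n p) (σ : ℝ) (s : E n) :
    Prop where
  decrease : model f₀ J T σ s - model f₀ J T σ 0 ≤ 0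
  gradient_small : ‖gradient (approxTaylor f₀ J T) s‖ ≤ θ₁ * σ * ‖s‖ ^ p / (p ! : ℝ)
  curvature_small : max 0 (-lambdaMin (hessian (approxTaylor f₀ J T) s))
    ≤ θ₂ * σ * ‖s‖ ^ (p - 1) / ((p - 1)! : ℝ)

/-- The program executed in iteration `k` of a run with iterates `x`, steps `s`, tensors `T`. (For
`k = 0` the tensor is refreshed, so that the value used for the previous tensor is irrelevant.) -/
def runIteration {n p : ℕ} (m : ℕ) (x s : ℕ → E n) (T : ℕ → Tensor n p) (k : ℕ) :
    OracleProg (E n) (Jet n) (Jet n × Tensor n p) :=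
  iteration p m k (x k) (fdStep m s k) (T (k - 1))

/-- The sequences `x, s, σ, T` are produced by the first `N` iterations of the finite-difference
algorithm started at `x₀` with regularization parameter `σ₀`.

The difference quotients of a refresh make sense only for `h_k > 0`; this is required unless `x_k`
is already an exact second-order critical point (in which case the tensor does not matter). -/
structure IsRun {n p : ℕ} (m : ℕ) (σ₀ θ₁ θ₂ : ℝ) (f : E n → ℝ) (x₀ : E n) (N : ℕ)
    (x s : ℕ → E n) (σ : ℕ → ℝ) (T : ℕ → Tensor n p) : Prop where
  x_zero : x 0 = x₀
  σ_zero : σ 0 = σ₀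
  fdStep_pos : ∀ k < N, k % m = 0 → 0 < fdStep m s k ∨ SecondOrderStationary f 0 0 (x k)
  tensor : ∀ k < N, T k = ((runIteration m x s T k).result (derivOracle p f)).2
  step : ∀ k < N, StepAccepted θ₁ θ₂ (f (x k))
    ((runIteration m x s T k).result (derivOracle p f)).1 (T k) (σ k) (s k)
  x_succ : ∀ k < N, x (k + 1) = x k + s k
  σ_succ : ∀ k < N, σ (k + 1) = σ k + σ k * ‖s k‖ ^ (p + 1)

/-- The number of evaluations of `{∇ⁱf}_{i=1}^{p-1}` made in the iterations `0, …, N - 1`. -/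
def evaluations {n p : ℕ} (m : ℕ) (f : E n → ℝ) (x s : ℕ → E n) (T : ℕ → Tensor n p) (N : ℕ) : ℕ :=
  ∑ k ∈ Finset.range N, (runIteration m x s T k).calls (derivOracle p f)

/-- `max[ε₁^{-(p+1)/p}, ε₂^{-(p+1)/(p-1)}]`. -/
def rate (p : ℕ) (ε₁ ε₂ : ℝ) : ℝ :=
  max (ε₁ ^ (-((p : ℝ) + 1) / (p : ℝ))) (ε₂ ^ (-((p : ℝ) + 1) / ((p : ℝ) - 1)))

end

end ARpFD

/-!
Write `S_k` for the sum of the last `2 m + 1` step lengths. The finite differences approximate the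
`p`-th derivative at `x_k` with an error at most `L * S_k`: the norm of a sum of `n` terms
`M_i ⊗ e_i` costs a factor `√n`, which the `1 / √n` in the discretization step cancels, so that the
dimension does not matter. Hence the inexact model behaves like an exact Taylor model of order `p`,
with `S_k` in place of `‖s_k‖`: the decrease of `f` controls `σ_k ‖s_k‖^{p+1}` up to a multiple of
`S_k^{p+1}`, and the gradient and the negative curvature at `x_{k+1}` are at most multiples of
`S_k^p` and `S_k^{p-1}`.

The parameter `σ` limits its own growth. Since `σ_{k+1} - σ_k = σ_k ‖s_k‖^{p+1}`, telescoping the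
decrease of `f` bounds the total growth of `σ` by a constant plus `C * ∑ ‖s_k‖^{p+1}`; but as soon
as `σ > 2 C`, it grows twice as fast as `C * ∑ ‖s_k‖^{p+1}`, which is impossible for long. As the
step that crosses this threshold is bounded too, `σ` stays bounded, and so does `∑ ‖s_k‖^{p+1}`,
hence also `∑ S_k^{p+1}`. As long as no stationary point is reached, each `S_k^{p+1}` is at least a
multiple of `1 / rate p ε₁ ε₂`, which bounds the number of iterations.
-/

namespace ARpFD

section Calculus

variable {V F : Type*} [NormedAddCommGroup V] [NormedSpace ℝ V]
  [NormedAddCommGroup F] [NormedSpace ℝ F]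

theorem iteratedFDeriv_add_two_apply (f : V → F) (k : ℕ) (x : V) (v : Fin (k + 2) → V) :
    iteratedFDeriv ℝ (k + 2) f x v =
      fderiv ℝ (fderiv ℝ (iteratedFDeriv ℝ k f)) x (v 0) (v 1) (Fin.tail (Fin.tail v)) := by
  have hcurry := LinearIsometryEquiv.comp_fderiv (𝕜 := ℝ)
    (continuousMultilinearCurryLeftEquiv ℝ (fun _ : Fin (k + 1) => V) F).symm
    (f := fderiv ℝ (iteratedFDeriv ℝ k f)) (x := x)
  exact congrArg (fun A => A (v 0) (Fin.tail v)) hcurry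

theorem iteratedFDeriv_comp_swap_zero {f : V → F} {k : ℕ} (hf : ContDiff ℝ (k + 2 : ℕ) f) (x : V)
    (v : Fin (k + 2) → V) :
    iteratedFDeriv ℝ (k + 2) f x (v ∘ Equiv.swap 0 1) = iteratedFDeriv ℝ (k + 2) f x v := by
  have hk : ContDiff ℝ 2 (iteratedFDeriv ℝ k f) :=
    hf.iteratedFDeriv_right (by norm_cast; omega)
  have hsymm : IsSymmSndFDerivAt ℝ (iteratedFDeriv ℝ k f) x :=
    hk.contDiffAt.isSymmSndFDerivAt (by simp)
  have htail : Fin.tail (Fin.tail (v ∘ Equiv.swap 0 1)) = Fin.tail (Fin.tail v) := by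
    funext i
    exact congrArg v (Equiv.swap_apply_of_ne_of_ne (Fin.succ_ne_zero _)
      fun h => Fin.succ_ne_zero i (Fin.succ_injective _ h))
  rw [iteratedFDeriv_add_two_apply, iteratedFDeriv_add_two_apply, htail, ← hsymm.eq]
  simp

theorem fderiv_apply_comp_perm {r : ℕ} {g : V → ContinuousMultilinearMap ℝ (fun _ : Fin r => V) F}
    {τ : Equiv.Perm (Fin r)} (hg : ∀ y v, g y (v ∘ τ) = g y v) (x u : V) (v : Fin r → V) :
    fderiv ℝ g x u (v ∘ τ) = fderiv ℝ g x u v := by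
  have hfix : ContinuousMultilinearMap.domDomCongrₗᵢ ℝ V F τ ∘ g = g := by
    funext y
    ext w
    exact hg y w
  conv_rhs => rw [← hfix, LinearIsometryEquiv.comp_fderiv]
  rfl

theorem iteratedFDeriv_comp_swap {f : V → F} {k : ℕ} (hf : ContDiff ℝ (k + 1 : ℕ) f) (x : V)
    (i : Fin k) (v : Fin (k + 1) → V) :
    iteratedFDeriv ℝ (k + 1) f x (v ∘ Equiv.swap i.castSucc i.succ) =
      iteratedFDeriv ℝ (k + 1) f x v := by
  induction k generalizing x with
  | zero => exact i.elim0
  | succ k ih =>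
    induction i using Fin.cases with
    | zero => exact iteratedFDeriv_comp_swap_zero hf x v
    | succ j =>
      have hhead : (v ∘ Equiv.swap j.succ.castSucc j.succ.succ) 0 = v 0 :=
        congrArg v (Equiv.swap_apply_of_ne_of_ne (by simp [Fin.ext_iff]) (by simp [Fin.ext_iff]))
      have htail : Fin.tail (v ∘ Equiv.swap j.succ.castSucc j.succ.succ) =
          Fin.tail v ∘ Equiv.swap j.castSucc j.succ := by
        funext i
        rw [Fin.castSucc_succ]
        exact congrArg v ((Fin.succ_injective _).swap_apply _ _ _)
      have hfk : ContDiff ℝ (k + 1 : ℕ) f := hf.of_le (by exact_mod_cast Nat.le_succ _)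
      rw [iteratedFDeriv_succ_apply_left, iteratedFDeriv_succ_apply_left, hhead, htail,
        fderiv_apply_comp_perm fun y w => ih hfk y j w]

theorem iteratedFDeriv_comp_perm {f : V → F} {k : ℕ} (hf : ContDiff ℝ k f) (x : V)
    (τ : Equiv.Perm (Fin k)) (v : Fin k → V) :
    iteratedFDeriv ℝ k f x (v ∘ τ) = iteratedFDeriv ℝ k f x v := by
  cases k with
  | zero => exact congrArg _ (Subsingleton.elim _ _)
  | succ k =>
    have hτ : τ ∈ Submonoid.closure
        (Set.range fun i : Fin k => Equiv.swap i.castSucc i.succ) := by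
      rw [Equiv.Perm.mclosure_swap_castSucc_succ]
      trivial
    induction hτ using Submonoid.closure_induction generalizing v with
    | mem τ h =>
      obtain ⟨i, rfl⟩ := h
      exact iteratedFDeriv_comp_swap hf x i v
    | one => rfl
    | mul a b _ _ iha ihb => rw [Equiv.Perm.coe_mul, ← Function.comp_assoc, ihb, iha]

theorem norm_fderiv_iteratedFDeriv_sub (f : V → F) (q : ℕ) (x y : V) :
    ‖fderiv ℝ (iteratedFDeriv ℝ q f) y - fderiv ℝ (iteratedFDeriv ℝ q f) x‖ =
      ‖iteratedFDeriv ℝ (q + 1) f y - iteratedFDeriv ℝ (q + 1) f x‖ :=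
  ((continuousMultilinearCurryLeftEquiv ℝ (fun _ : Fin (q + 1) => V) F).symm.norm_map _).symm

theorem norm_add_sub_sub_fderiv_le {g : V → F} (hg : Differentiable ℝ g) {x : V} {L : ℝ}
    (hL : 0 ≤ L) (hlip : ∀ y, ‖fderiv ℝ g y - fderiv ℝ g x‖ ≤ L * ‖y - x‖) (d : V) :
    ‖g (x + d) - g x - fderiv ℝ g x d‖ ≤ L * ‖d‖ ^ 2 := by
  have hbound : ∀ z ∈ Metric.closedBall x ‖d‖, ‖fderiv ℝ g z - fderiv ℝ g x‖ ≤ L * ‖d‖ :=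
    fun z hz => (hlip z).trans (by gcongr; exact mem_closedBall_iff_norm.1 hz)
  have h := (convex_closedBall x ‖d‖).norm_image_sub_le_of_norm_fderiv_le'
    (fun z _ => hg z) hbound (Metric.mem_closedBall_self (norm_nonneg d))
    (y := x + d) (by simp)
  rwa [add_sub_cancel_left, mul_assoc, ← sq] at h

theorem norm_iteratedFDeriv_le_of_vanish {g : V → F} {p : ℕ} (hg : ContDiff ℝ p g)
    (h0 : ∀ i < p, iteratedFDeriv ℝ i g 0 = 0) {M r : ℝ} (hr : 0 ≤ r)
    (hM : ∀ y, ‖y‖ ≤ r → ‖iteratedFDeriv ℝ p g y‖ ≤ M) {i : ℕ} (hi : i ≤ p) :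
    ∀ y, ‖y‖ ≤ r → ‖iteratedFDeriv ℝ i g y‖ ≤ M * r ^ (p - i) := by
  have hM0 : 0 ≤ M := (norm_nonneg _).trans (hM 0 (by simpa using hr))
  induction hi using Nat.decreasingInduction with
  | self => simpa using hM
  | of_succ i hi ih =>
    intro y hy
    have hd : Differentiable ℝ (iteratedFDeriv ℝ i g) :=
      hg.differentiable_iteratedFDeriv (by exact_mod_cast hi)
    have h := (convex_closedBall (0 : V) r).norm_image_sub_le_of_norm_fderiv_le
      (𝕜 := ℝ) (fun z _ => hd z)
      (fun z hz => by
        rw [norm_fderiv_iteratedFDeriv]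
        exact ih z (by simpa using hz))
      (Metric.mem_closedBall_self hr) (y := y) (by simpa using hy)
    rw [h0 i hi, sub_zero, sub_zero] at h
    calc ‖iteratedFDeriv ℝ i g y‖ ≤ M * r ^ (p - (i + 1)) * ‖y‖ := h
      _ ≤ M * r ^ (p - (i + 1)) * r := by gcongr
      _ = M * r ^ (p - i) := by
        rw [mul_assoc, ← pow_succ]
        congr 2
        omega

theorem contDiff_diagonal {r : ℕ} (M : ContinuousMultilinearMap ℝ (fun _ : Fin r => V) F)
    {k : WithTop ℕ∞} : ContDiff ℝ k fun s => M fun _ => s :=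
  M.contDiff.comp (contDiff_pi.2 fun _ => contDiff_id)

theorem norm_iteratedFDeriv_diagonal_le {r : ℕ}
    (M : ContinuousMultilinearMap ℝ (fun _ : Fin r => V) F) (k : ℕ) (s : V) :
    ‖iteratedFDeriv ℝ k (fun s => M fun _ => s) s‖ ≤
      r.descFactorial k * ‖M‖ * ‖s‖ ^ (r - k) := by
  let diag : V →L[ℝ] (Fin r → V) := ContinuousLinearMap.pi fun _ => ContinuousLinearMap.id ℝ V
  have hdiag : ‖diag‖ ≤ 1 := ContinuousLinearMap.opNorm_le_bound _ zero_le_one fun v => by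
    rw [one_mul]
    exact (pi_norm_le_iff_of_nonneg (norm_nonneg v)).2 fun _ => le_rfl
  have hs : ‖diag s‖ ≤ ‖s‖ := by simpa using diag.le_of_opNorm_le hdiag s
  change ‖iteratedFDeriv ℝ k (M ∘ diag) s‖ ≤ _
  rw [diag.iteratedFDeriv_comp_right M.contDiff s le_rfl]
  calc _ ≤ ‖iteratedFDeriv ℝ k M (diag s)‖ * ∏ _ : Fin k, ‖diag‖ :=
        ContinuousMultilinearMap.norm_compContinuousLinearMap_le _ _
    _ ≤ ‖iteratedFDeriv ℝ k M (diag s)‖ * 1 := by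
        gcongr
        exact Finset.prod_le_one (fun _ _ => norm_nonneg _) fun _ _ => hdiag
    _ ≤ r.descFactorial k * ‖M‖ * ‖s‖ ^ (r - k) := by
        rw [mul_one]
        refine (M.norm_iteratedFDeriv_le k (diag s)).trans ?_
        rw [Fintype.card_fin]
        gcongr

theorem iteratedFDeriv_diagonal_of_lt {r k : ℕ}
    (M : ContinuousMultilinearMap ℝ (fun _ : Fin r => V) F) (h : r < k) (s : V) :
    iteratedFDeriv ℝ k (fun s => M fun _ => s) s = 0 := by
  simpa [Nat.descFactorial_of_lt h] using norm_iteratedFDeriv_diagonal_le M k s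

theorem iteratedFDeriv_diagonal_zero_of_gt {r k : ℕ}
    (M : ContinuousMultilinearMap ℝ (fun _ : Fin r => V) F) (h : k < r) :
    iteratedFDeriv ℝ k (fun s => M fun _ => s) 0 = 0 := by
  simpa [(Nat.sub_pos_of_lt h).ne'] using norm_iteratedFDeriv_diagonal_le M k 0

end Calculus

section Symmetrization

variable {n r : ℕ}

theorem symmetrize_apply (T : Tensor n r) (v : Fin r → E n) :
    symmetrize T v = (1 / (r ! : ℝ)) * ∑ τ : Equiv.Perm (Fin r), T (v ∘ τ) := by
  simp [symmetrize, Function.comp_def]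

theorem symmetrize_sub (T S : Tensor n r) : symmetrize (T - S) = symmetrize T - symmetrize S := by
  ext v
  simp only [symmetrize_apply, _root_.sub_apply, Finset.sum_sub_distrib, mul_sub]

theorem symmetrize_eq_self {T : Tensor n r}
    (hT : ∀ (τ : Equiv.Perm (Fin r)) v, T (v ∘ τ) = T v) : symmetrize T = T := by
  ext v
  have hr : (r ! : ℝ) ≠ 0 := by exact_mod_cast r.factorial_ne_zero
  simp [symmetrize_apply, hT, Fintype.card_perm, hr]

theorem symmetrize_symmetrize (T : Tensor n r) : symmetrize (symmetrize T) = symmetrize T := by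
  refine symmetrize_eq_self fun τ v => ?_
  rw [symmetrize_apply, symmetrize_apply]
  exact congrArg _ (Fintype.sum_equiv (Equiv.mulLeft τ) _ _ fun _ => rfl)

theorem symmetrize_iteratedFDeriv {f : E n → ℝ} (hf : ContDiff ℝ r f) (x : E n) :
    symmetrize (iteratedFDeriv ℝ r f x) = iteratedFDeriv ℝ r f x :=
  symmetrize_eq_self (iteratedFDeriv_comp_perm hf x)

theorem norm_symmetrize_le (T : Tensor n r) : ‖symmetrize T‖ ≤ ‖T‖ := by
  calc ‖symmetrize T‖ ≤ (1 / (r ! : ℝ)) * ∑ τ : Equiv.Perm (Fin r), ‖T.domDomCongr τ‖ := by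
        rw [symmetrize, norm_smul, Real.norm_of_nonneg (by positivity)]
        gcongr
        exact norm_sum_le _ _
    _ = ‖T‖ := by
        simp only [ContinuousMultilinearMap.norm_domDomCongr ℝ (E n) ℝ, Finset.sum_const,
          Finset.card_univ, Fintype.card_perm, Fintype.card_fin, nsmul_eq_mul]
        rw [one_div, inv_mul_cancel_left₀ (by positivity)]

theorem norm_symmetrize_sub_le (T : Tensor n r) {S : Tensor n r} (hS : symmetrize S = S) :
    ‖symmetrize T - S‖ ≤ ‖T - S‖ := by
  conv_lhs => rw [← hS, ← symmetrize_sub]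
  exact norm_symmetrize_le _

theorem iteratedFDeriv_diagonal_self (T : Tensor n r) (s : E n) :
    (1 / (r ! : ℝ)) • iteratedFDeriv ℝ r (fun s => T fun _ => s) s = symmetrize T := by
  ext v
  rw [_root_.smul_apply, T.iteratedFDeriv_comp_diagonal, symmetrize_apply, smul_eq_mul]
  rfl

end Symmetrization

section InexactTaylor

variable {n p : ℕ}

theorem contDiff_approxTaylor (f₀ : ℝ) (J : Jet n) (T : Tensor n p) {k : WithTop ℕ∞} :
    ContDiff ℝ k (approxTaylor f₀ J T) :=
  (contDiff_const.add (ContDiff.sum fun _ _ => contDiff_const.mul (contDiff_diagonal _))).add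
    (contDiff_const.mul (contDiff_diagonal _))

theorem iteratedFDeriv_approxTaylor (f₀ : ℝ) (J : Jet n) (T : Tensor n p) {k : ℕ} (hk : k ≠ 0)
    (s : E n) :
    iteratedFDeriv ℝ k (approxTaylor f₀ J T) s =
      ∑ i ∈ Finset.Icc 1 (p - 1),
        (1 / (i ! : ℝ)) • iteratedFDeriv ℝ k (fun s => J i fun _ => s) s
      + (1 / (p ! : ℝ)) • iteratedFDeriv ℝ k (fun s => T fun _ => s) s := by
  have hterm : ∀ {r : ℕ} (M : Tensor n r), ContDiff ℝ k fun s => (1 / (r ! : ℝ)) • M fun _ => s :=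
    fun M => (contDiff_diagonal M).const_smul _
  let S : E n → ℝ := fun s => ∑ i ∈ Finset.Icc 1 (p - 1), (1 / (i ! : ℝ)) • J i fun _ => s
  have hS : ContDiff ℝ k S := ContDiff.sum fun i _ => hterm (J i)
  have hconstS : ContDiff ℝ k ((fun _ => f₀) + S) := contDiff_const.add hS
  have happrox : approxTaylor f₀ J T =
      ((fun _ => f₀) + S) + fun s => (1 / (p ! : ℝ)) • T fun _ => s := rfl
  rw [happrox, iteratedFDeriv_add_apply hconstS.contDiffAt (hterm T).contDiffAt,
    iteratedFDeriv_add_apply contDiffAt_const hS.contDiffAt,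
    iteratedFDeriv_fun_sum_apply fun i _ => (hterm (J i)).contDiffAt,
    iteratedFDeriv_const_of_ne hk, Pi.zero_apply, zero_add,
    iteratedFDeriv_const_smul_apply' (contDiff_diagonal T).contDiffAt]
  congr 1
  exact Finset.sum_congr rfl fun i _ =>
    iteratedFDeriv_const_smul_apply' (contDiff_diagonal (J i)).contDiffAt

theorem iteratedFDeriv_approxTaylor_zero (f₀ : ℝ) (J : Jet n) (T : Tensor n p) {k : ℕ}
    (hk : k ≠ 0) (hkp : k < p) :
    iteratedFDeriv ℝ k (approxTaylor f₀ J T) 0 = symmetrize (J k) := by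
  rw [iteratedFDeriv_approxTaylor f₀ J T hk, iteratedFDeriv_diagonal_zero_of_gt T hkp, smul_zero,
    add_zero, Finset.sum_eq_single_of_mem k (Finset.mem_Icc.2 ⟨by omega, by omega⟩),
    iteratedFDeriv_diagonal_self]
  intro i _ hik
  rcases hik.lt_or_gt with h | h
  · rw [iteratedFDeriv_diagonal_of_lt _ h, smul_zero]
  · rw [iteratedFDeriv_diagonal_zero_of_gt _ h, smul_zero]

theorem iteratedFDeriv_approxTaylor_top (f₀ : ℝ) (J : Jet n) (T : Tensor n p) (hp : p ≠ 0)
    (s : E n) : iteratedFDeriv ℝ p (approxTaylor f₀ J T) s = symmetrize T := by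
  rw [iteratedFDeriv_approxTaylor f₀ J T hp, iteratedFDeriv_diagonal_self, Finset.sum_eq_zero,
    zero_add]
  intro i hi
  rw [Finset.mem_Icc] at hi
  rw [iteratedFDeriv_diagonal_of_lt _ (by omega), smul_zero]

theorem approxTaylor_zero (f₀ : ℝ) (J : Jet n) (T : Tensor n p) (hp : p ≠ 0) :
    approxTaylor f₀ J T 0 = f₀ := by
  have hzero : ∀ {r : ℕ}, r ≠ 0 → ∀ M : Tensor n r, (M fun _ => (0 : E n)) = 0 :=
    fun {r} hr M => M.map_coord_zero (⟨0, Nat.pos_of_ne_zero hr⟩ : Fin r) rfl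
  have hsum : ∑ i ∈ Finset.Icc 1 (p - 1), (1 / (i ! : ℝ)) * (J i fun _ => (0 : E n)) = 0 :=
    Finset.sum_eq_zero fun i hi => by
      rw [hzero (Nat.one_le_iff_ne_zero.1 (Finset.mem_Icc.1 hi).1), mul_zero]
  rw [approxTaylor, hsum, hzero hp, mul_zero, add_zero, add_zero]

theorem derivOracle_eq {i : ℕ} (f : E n → ℝ) (x : E n) (hi : i ≠ 0) (hip : i < p) :
    derivOracle p f x i = iteratedFDeriv ℝ i f x :=
  if_pos ⟨by omega, by omega⟩

theorem iteratedFDeriv_approxTaylor_derivOracle_zero {f : E n → ℝ} (hf : ContDiff ℝ p f)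
    (x : E n) (T : Tensor n p) {i : ℕ} (hi : i < p) :
    iteratedFDeriv ℝ i (approxTaylor (f x) (derivOracle p f x) T) 0 = iteratedFDeriv ℝ i f x := by
  rcases eq_or_ne i 0 with rfl | hi0
  · ext v
    simp only [iteratedFDeriv_zero_apply, approxTaylor_zero _ _ _ hi.ne']
  · rw [iteratedFDeriv_approxTaylor_zero _ _ _ hi0 hi, derivOracle_eq f x hi0 hi,
      symmetrize_iteratedFDeriv (hf.of_le (by exact_mod_cast hi.le))]

theorem norm_iteratedFDeriv_sub_approxTaylor_le {f : E n → ℝ} (hp : p ≠ 0)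
    (hf : ContDiff ℝ p f) {L : ℝ} (hL : 0 ≤ L)
    (hlip : ∀ x y, ‖iteratedFDeriv ℝ p f x - iteratedFDeriv ℝ p f y‖ ≤ L * ‖x - y‖)
    {T : Tensor n p} (hT : symmetrize T = T) (x s : E n) {i : ℕ} (hi : i ≤ p) :
    ‖iteratedFDeriv ℝ i f (x + s)
        - iteratedFDeriv ℝ i (approxTaylor (f x) (derivOracle p f x) T) s‖
      ≤ (L * ‖s‖ + ‖T - iteratedFDeriv ℝ p f x‖) * ‖s‖ ^ (p - i) := by
  set P := approxTaylor (f x) (derivOracle p f x) T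
  have hP : ∀ {k : WithTop ℕ∞}, ContDiff ℝ k P := contDiff_approxTaylor _ _ _
  have hshift : ContDiff ℝ p fun s => f (x + s) := hf.comp (contDiff_const.add contDiff_id)
  have hsub : ∀ i ≤ p, ∀ s, iteratedFDeriv ℝ i ((fun s => f (x + s)) - P) s =
      iteratedFDeriv ℝ i f (x + s) - iteratedFDeriv ℝ i P s := by
    intro i hi s
    rw [iteratedFDeriv_sub_apply (hshift.of_le (by exact_mod_cast hi)).contDiffAt hP.contDiffAt,
      iteratedFDeriv_comp_add_left]
  have hvanish : ∀ i < p, iteratedFDeriv ℝ i ((fun s => f (x + s)) - P) 0 = 0 := by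
    intro i hi
    rw [hsub i hi.le, add_zero, iteratedFDeriv_approxTaylor_derivOracle_zero hf x T hi, sub_self]
  have htop : ∀ y, ‖y‖ ≤ ‖s‖ → ‖iteratedFDeriv ℝ p ((fun s => f (x + s)) - P) y‖ ≤
      L * ‖s‖ + ‖T - iteratedFDeriv ℝ p f x‖ := by
    intro y hy
    rw [hsub p le_rfl, iteratedFDeriv_approxTaylor_top _ _ _ hp, hT,
      ← sub_sub_sub_cancel_right _ _ (iteratedFDeriv ℝ p f x)]
    refine (norm_sub_le _ _).trans (add_le_add_left ((hlip _ _).trans ?_) _)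
    rw [add_sub_cancel_left]
    gcongr
  rw [← hsub i hi]
  exact norm_iteratedFDeriv_le_of_vanish (hshift.sub hP) hvanish (norm_nonneg s) htop hi s le_rfl

end InexactTaylor

section Curvature

theorem norm_gradient {V : Type*} [NormedAddCommGroup V] [InnerProductSpace ℝ V] [CompleteSpace V]
    (f : V → ℝ) (x : V) : ‖gradient f x‖ = ‖iteratedFDeriv ℝ 1 f x‖ := by
  rw [gradient, LinearIsometryEquiv.norm_map, norm_iteratedFDeriv_one]

variable {n : ℕ}

theorem sum_smul_e (v : E n) : ∑ i, v i • (e i : E n) = v := by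
  ext j
  simp [e, Pi.single_apply]

open scoped MatrixOrder in
theorem le_lambdaMin_iff [NeZero n] {A : Matrix (Fin n) (Fin n) ℝ} (hA : A.IsHermitian) (b : ℝ) :
    b ≤ lambdaMin A ↔ ∀ v : Fin n → ℝ, b * (v ⬝ᵥ v) ≤ v ⬝ᵥ A.mulVec v := by
  have hspec := hA.spectrum_real_eq_range_eigenvalues
  have hfin : (spectrum ℝ A).Finite := hspec ▸ Set.finite_range _
  have hne : (spectrum ℝ A).Nonempty := hspec ▸ Set.range_nonempty _
  have hdiff : (A - algebraMap ℝ _ b).IsHermitian := IsSelfAdjoint.sub hA (.algebraMap _ (.all b))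
  rw [lambdaMin, le_csInf_iff hfin.bddBelow hne, ← algebraMap_le_iff_le_spectrum hA, Matrix.le_iff,
    Matrix.posSemidef_iff_dotProduct_mulVec, and_iff_right hdiff]
  simp only [Matrix.sub_mulVec, Algebra.algebraMap_eq_smul_one, Matrix.smul_mulVec,
    Matrix.one_mulVec, dotProduct_sub, dotProduct_smul, smul_eq_mul, star_trivial, sub_nonneg]

theorem hessian_isHermitian {g : E n → ℝ} (hg : ContDiff ℝ 2 g) (x : E n) :
    (hessian g x).IsHermitian := by
  ext i j
  have hswap : ![e i, e j] ∘ Equiv.swap 0 1 = ![e j, (e i : E n)] := by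
    funext k
    fin_cases k <;> simp
  simpa [hessian, hswap] using iteratedFDeriv_comp_perm (k := 2) hg x (Equiv.swap 0 1) ![e i, e j]

theorem dotProduct_hessian_mulVec (g : E n → ℝ) (x v : E n) :
    v.ofLp ⬝ᵥ (hessian g x).mulVec v.ofLp = iteratedFDeriv ℝ 2 g x fun _ => v := by
  rw [iteratedFDeriv_two_apply]
  conv_rhs => rw [← sum_smul_e v]
  simp only [map_sum, map_smul, _root_.sum_apply, _root_.smul_apply, dotProduct, Matrix.mulVec,
    hessian, Matrix.of_apply, iteratedFDeriv_two_apply, smul_eq_mul, Matrix.cons_val_zero,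
    Matrix.cons_val_one, Finset.mul_sum]
  rw [Finset.sum_comm]
  exact Finset.sum_congr rfl fun i _ => Finset.sum_congr rfl fun j _ => by ring

theorem le_lambdaMin_hessian_iff [NeZero n] {g : E n → ℝ} (hg : ContDiff ℝ 2 g) (x : E n)
    (b : ℝ) : b ≤ lambdaMin (hessian g x) ↔
      ∀ v : E n, b * ‖v‖ ^ 2 ≤ iteratedFDeriv ℝ 2 g x fun _ => v := by
  have hnorm : ∀ v : E n, v.ofLp ⬝ᵥ v.ofLp = ‖v‖ ^ 2 := fun v => by
    rw [EuclideanSpace.real_norm_sq_eq]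
    simp only [dotProduct, sq]
  rw [le_lambdaMin_iff (hessian_isHermitian hg x), (WithLp.toLp_surjective 2).forall]
  simp only [← hnorm, ← dotProduct_hessian_mulVec]

theorem lambdaMin_hessian_sub_le [NeZero n] {f g : E n → ℝ} (hf : ContDiff ℝ 2 f)
    (hg : ContDiff ℝ 2 g) (x y : E n) :
    lambdaMin (hessian g y) - ‖iteratedFDeriv ℝ 2 f x - iteratedFDeriv ℝ 2 g y‖ ≤
      lambdaMin (hessian f x) := by
  rw [le_lambdaMin_hessian_iff hf]
  intro v
  have hmin := (le_lambdaMin_hessian_iff hg y _).1 le_rfl v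
  have hdiff := (iteratedFDeriv ℝ 2 f x - iteratedFDeriv ℝ 2 g y).le_opNorm fun _ => v
  rw [_root_.sub_apply, Finset.prod_const, Finset.card_univ, Fintype.card_fin] at hdiff
  linarith [neg_le_of_abs_le hdiff]

end Curvature

section FiniteDifferences

variable {n q : ℕ}

theorem norm_dividedDifference_sub_fderiv_le {V F : Type*} [NormedAddCommGroup V]
    [NormedSpace ℝ V] [NormedAddCommGroup F] [NormedSpace ℝ F] {g : V → F}
    (hg : Differentiable ℝ g) {x : V} {L : ℝ} (hL : 0 ≤ L)
    (hlip : ∀ y, ‖fderiv ℝ g y - fderiv ℝ g x‖ ≤ L * ‖y - x‖) {h : ℝ} (hh : 0 < h) (u : V) :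
    ‖h⁻¹ • (g (x + h • u) - g x) - fderiv ℝ g x u‖ ≤ L * h * ‖u‖ ^ 2 := by
  have htaylor := norm_add_sub_sub_fderiv_le hg hL hlip (h • u)
  calc ‖h⁻¹ • (g (x + h • u) - g x) - fderiv ℝ g x u‖
      = h⁻¹ * ‖g (x + h • u) - g x - fderiv ℝ g x (h • u)‖ := by
        rw [← Real.norm_of_nonneg (inv_nonneg.2 hh.le), ← norm_smul, smul_sub h⁻¹ (_ - _),
          map_smul, inv_smul_smul₀ hh.ne', Real.norm_of_nonneg (inv_nonneg.2 hh.le)]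
    _ ≤ h⁻¹ * (L * ‖h • u‖ ^ 2) := by gcongr
    _ = L * h * ‖u‖ ^ 2 := by
        rw [norm_smul, Real.norm_of_nonneg hh.le]
        field_simp

theorem sum_abs_coord_le (v : E n) : ∑ i, |v i| ≤ √n * ‖v‖ := by
  have h := sq_sum_le_card_mul_sum_sq (s := (Finset.univ : Finset (Fin n))) (f := fun i => |v i|)
  rw [EuclideanSpace.norm_eq, ← Real.sqrt_mul (Nat.cast_nonneg n)]
  exact Real.le_sqrt_of_sq_le (by simpa using h)

theorem tensorBasis_sub (M N : Tensor n q) (i : Fin n) :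
    tensorBasis (M - N) i = tensorBasis M i - tensorBasis N i := by
  ext v
  simp only [tensorBasis_apply, _root_.sub_apply, sub_mul]

theorem norm_sum_tensorBasis_le {M : Fin n → Tensor n q} {C : ℝ} (hC : 0 ≤ C)
    (hM : ∀ i, ‖M i‖ ≤ C) : ‖∑ i, tensorBasis (M i) i‖ ≤ √n * C := by
  refine ContinuousMultilinearMap.opNorm_le_bound (by positivity) fun v => ?_
  simp only [_root_.sum_apply, tensorBasis_apply]
  calc ‖∑ i, M i (fun j => v j.castSucc) * v (Fin.last q) i‖
      ≤ ∑ i, C * (∏ j : Fin q, ‖v j.castSucc‖) * |v (Fin.last q) i| := by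
        refine norm_sum_le_of_le _ fun i _ => ?_
        rw [norm_mul]
        exact mul_le_mul_of_nonneg_right ((M i).le_of_opNorm_le (hM i) _) (abs_nonneg _)
    _ ≤ C * (∏ j : Fin q, ‖v j.castSucc‖) * (√n * ‖v (Fin.last q)‖) := by
        rw [← Finset.mul_sum]
        gcongr
        exact sum_abs_coord_le _
    _ = √n * C * ∏ i, ‖v i‖ := by
        rw [Fin.prod_univ_castSucc]
        ring

theorem iteratedFDeriv_succ_eq_sum_tensorBasis {f : E n → ℝ} (hf : ContDiff ℝ (q + 1 : ℕ) f)
    (x : E n) : iteratedFDeriv ℝ (q + 1) f x =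
      ∑ i, tensorBasis (fderiv ℝ (iteratedFDeriv ℝ q f) x (e i)) i := by
  ext v
  have hrotate : v = (Fin.cons (v (Fin.last q)) (Fin.init v) : Fin (q + 1) → E n) ∘
      finRotate (q + 1) := by
    conv_lhs => rw [← Fin.snoc_init_self v, Fin.snoc_eq_cons_rotate]
    rfl
  conv_lhs => rw [hrotate, iteratedFDeriv_comp_perm hf, iteratedFDeriv_succ_apply_left,
    Fin.cons_zero, Fin.tail_cons, ← sum_smul_e (v (Fin.last q))]
  simp [tensorBasis_apply, map_sum, Fin.init_def, mul_comm]

/-- The factor `1 / √n` in `fdStep` makes this error independent of the dimension. -/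
theorem norm_symmetrize_fdTensor_sub_le {p : ℕ} {f : E n → ℝ} (hp : 2 ≤ p) (hf : ContDiff ℝ p f)
    {L : ℝ} (hL : 0 ≤ L)
    (hlip : ∀ x y, ‖iteratedFDeriv ℝ p f x - iteratedFDeriv ℝ p f y‖ ≤ L * ‖x - y‖)
    {h : ℝ} (hh : 0 < h) (x : E n) :
    ‖symmetrize (fdTensor h (derivOracle p f x) (fun i => derivOracle p f (x + h • e i)) p)
      - iteratedFDeriv ℝ p f x‖ ≤ L * (√n * h) := by
  obtain ⟨q, rfl⟩ : ∃ q, p = q + 1 := ⟨p - 1, by omega⟩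
  refine (norm_symmetrize_sub_le _ (symmetrize_iteratedFDeriv hf x)).trans ?_
  have hdiff : Differentiable ℝ (iteratedFDeriv ℝ q f) :=
    hf.differentiable_iteratedFDeriv (by exact_mod_cast Nat.lt_succ_self q)
  have hcol : ∀ i, ‖h⁻¹ • (iteratedFDeriv ℝ q f (x + h • e i) - iteratedFDeriv ℝ q f x)
      - fderiv ℝ (iteratedFDeriv ℝ q f) x (e i)‖ ≤ L * h := fun i => by
    have hi := norm_dividedDifference_sub_fderiv_le hdiff hL
      (fun y => (norm_fderiv_iteratedFDeriv_sub f q x y).trans_le (hlip y x)) hh (e i)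
    rwa [e, PiLp.norm_single, norm_one, one_pow, mul_one] at hi
  have hq : ∀ y, derivOracle (q + 1) f y q = iteratedFDeriv ℝ q f y := fun y =>
    derivOracle_eq f y (by omega) q.lt_succ_self
  rw [iteratedFDeriv_succ_eq_sum_tensorBasis hf, fdTensor, ← Finset.sum_sub_distrib]
  simp only [hq, ← tensorBasis_sub]
  calc _ ≤ √n * (L * h) := norm_sum_tensorBasis_le (by positivity) hcol
    _ = L * (√n * h) := by ring

end FiniteDifferences

section OraclePrograms

theorem OracleProg.result_queryAll {Q A α : Type} (O : Q → A) (r : ℕ) (q : Fin r → Q)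
    (cont : (Fin r → A) → OracleProg Q A α) :
    (OracleProg.queryAll r q cont).result O = (cont (O ∘ q)).result O := by
  induction r with
  | zero => rw [OracleProg.queryAll, Subsingleton.elim (O ∘ q)]
  | succ r ih =>
    rw [OracleProg.queryAll, OracleProg.result, ih]
    exact congrArg (fun v => (cont v).result O) (Fin.cons_self_tail (O ∘ q))

theorem OracleProg.calls_queryAll {Q A α : Type} (O : Q → A) (r : ℕ) (q : Fin r → Q)
    (cont : (Fin r → A) → OracleProg Q A α) :
    (OracleProg.queryAll r q cont).calls O = (cont (O ∘ q)).calls O + r := by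
  induction r with
  | zero => rw [OracleProg.queryAll, Subsingleton.elim (O ∘ q), Nat.add_zero]
  | succ r ih =>
    rw [OracleProg.queryAll, OracleProg.calls, ih, Nat.add_assoc]
    exact congrArg (fun v => (cont v).calls O + (r + 1)) (Fin.cons_self_tail (O ∘ q))

variable {n p : ℕ} (m : ℕ) (f : E n → ℝ) (x s : ℕ → E n) (T : ℕ → Tensor n p) (k : ℕ)

theorem result_runIteration :
    (runIteration m x s T k).result (derivOracle p f) =
      (derivOracle p f (x k),
        if k % m = 0 then symmetrize (fdTensor (fdStep m s k) (derivOracle p f (x k))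
          (fun i => derivOracle p f (x k + fdStep m s k • e i)) p) else T (k - 1)) := by
  rw [runIteration, iteration, OracleProg.result]
  split_ifs
  · rw [OracleProg.result_queryAll]
    rfl
  · rfl

theorem calls_runIteration_le : (runIteration m x s T k).calls (derivOracle p f) ≤ n + 1 := by
  rw [runIteration, iteration, OracleProg.calls]
  split_ifs
  · rw [OracleProg.calls_queryAll, OracleProg.calls, Nat.zero_add]
  · rw [OracleProg.calls]
    omega

theorem evaluations_le (N : ℕ) : evaluations m f x s T N ≤ (n + 1) * N := by
  refine (Finset.sum_le_card_nsmul _ _ _ fun k _ => calls_runIteration_le m f x s T k).trans_eq ?_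
  rw [Finset.card_range, smul_eq_mul, mul_comm]

end OraclePrograms

section RecentSteps

variable {n : ℕ}

/-- The sum of the `r` step lengths `‖s_j‖, ‖s_{j-1}‖, …, ‖s_{j-r+1}‖`, with the convention
`‖s_i‖ = 1` for `i < 0`. The inaccuracy of the model at a given iteration is measured by it. -/
noncomputable def recentSteps (r : ℕ) (s : ℕ → E n) (j : ℤ) : ℝ :=
  ∑ i ∈ Finset.range r, stepNorm s (j - (i : ℕ))

theorem stepNorm_nonneg (s : ℕ → E n) (j : ℤ) : 0 ≤ stepNorm s j := by
  unfold stepNorm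
  split_ifs
  exacts [norm_nonneg _, zero_le_one]

theorem stepNorm_natCast (s : ℕ → E n) (k : ℕ) : stepNorm s k = ‖s k‖ := by
  simp [stepNorm]

theorem stepNorm_of_neg (s : ℕ → E n) {j : ℤ} (hj : j < 0) : stepNorm s j = 1 :=
  if_neg hj.not_ge

theorem recentSteps_nonneg (r : ℕ) (s : ℕ → E n) (j : ℤ) : 0 ≤ recentSteps r s j :=
  Finset.sum_nonneg fun _ _ => stepNorm_nonneg s _

theorem recentSteps_succ (r : ℕ) (s : ℕ → E n) (j : ℤ) :
    recentSteps (r + 1) s j = recentSteps r s (j - 1) + stepNorm s j := by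
  rw [recentSteps, Finset.sum_range_succ', Nat.cast_zero, sub_zero, recentSteps]
  congr! 3 with i
  push_cast
  ring

theorem recentSteps_mono (s : ℕ → E n) (j : ℤ) : Monotone fun r => recentSteps r s j :=
  fun _ _ h => Finset.sum_le_sum_of_subset_of_nonneg (Finset.range_subset_range.2 h)
    fun _ _ _ => stepNorm_nonneg s _

theorem norm_le_recentSteps (r : ℕ) (s : ℕ → E n) (k : ℕ) : ‖s k‖ ≤ recentSteps (r + 1) s k := by
  rw [recentSteps_succ, stepNorm_natCast]
  exact le_add_of_nonneg_left (recentSteps_nonneg r s _)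

theorem sqrt_mul_fdStep_le [NeZero n] (m : ℕ) (s : ℕ → E n) (k : ℕ) :
    √n * fdStep m s k ≤ recentSteps m s (k - 1) := by
  have hsqrt : √(n : ℝ) ≠ 0 := (Real.sqrt_pos.2 (by exact_mod_cast Nat.pos_of_neZero n)).ne'
  have hsum : ∑ i ∈ Finset.Icc 1 m, stepNorm s (k - (i : ℕ)) = recentSteps m s (k - 1) := by
    rw [← Finset.Ico_add_one_right_eq_Icc, Finset.sum_Ico_eq_sum_range, recentSteps]
    congr! 2 with i
    push_cast
    ring
  rw [fdStep, mul_div_cancel₀ _ hsqrt, hsum]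
  exact min_le_left _ _

theorem recentSteps_le_mul {s : ℕ → E n} {k : ℕ} {ρ : ℝ} (hρ : 1 ≤ ρ) (hs : ∀ i < k, ‖s i‖ ≤ ρ)
    (r : ℕ) {j : ℤ} (hj : j < k) : recentSteps r s j ≤ r * ρ := by
  have hstep : ∀ i : ℤ, i < k → stepNorm s i ≤ ρ := fun i hi => by
    rcases lt_or_ge i 0 with h | h
    · exact (stepNorm_of_neg s h).trans_le hρ
    · lift i to ℕ using h
      exact (stepNorm_natCast s i).trans_le (hs i (by exact_mod_cast hi))
  have h := Finset.sum_le_card_nsmul (Finset.range r) (fun i : ℕ => stepNorm s (j - i)) ρ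
    fun i _ => hstep _ (by omega)
  rwa [Finset.card_range, nsmul_eq_mul] at h

theorem sum_stepNorm_shift_pow_le (s : ℕ → E n) (q K i : ℕ) :
    ∑ k ∈ Finset.range K, stepNorm s (k - i) ^ q ≤ i + ∑ k ∈ Finset.range K, ‖s k‖ ^ q := by
  induction i with
  | zero => simp [stepNorm_natCast]
  | succ i ih =>
    cases K with
    | zero => simp only [Finset.range_zero, Finset.sum_empty, add_zero, Nat.cast_nonneg]
    | succ K =>
      have hshift : ∀ k : ℕ, ((k + 1 : ℕ) : ℤ) - (i + 1 : ℕ) = k - i := fun k => by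
        push_cast
        ring
      have hlast : 0 ≤ stepNorm s ((K : ℤ) - i) ^ q := pow_nonneg (stepNorm_nonneg s _) _
      rw [Finset.sum_range_succ', stepNorm_of_neg s (by omega), one_pow]
      simp only [hshift]
      rw [Finset.sum_range_succ] at ih
      push_cast
      linarith

theorem sum_recentSteps_pow_le (r q : ℕ) (s : ℕ → E n) (K : ℕ) :
    ∑ k ∈ Finset.range K, recentSteps r s k ^ (q + 1)
      ≤ (r : ℝ) ^ (q + 1) * (r + ∑ k ∈ Finset.range K, ‖s k‖ ^ (q + 1)) := by
  have hpow : ∀ k : ℕ, recentSteps r s k ^ (q + 1)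
      ≤ (r : ℝ) ^ q * ∑ i ∈ Finset.range r, stepNorm s (k - (i : ℕ)) ^ (q + 1) := fun k => by
    simpa only [recentSteps, Finset.card_range] using
      pow_sum_le_card_mul_sum_pow (s := Finset.range r)
        (f := fun i : ℕ => stepNorm s (k - i)) (fun i _ => stepNorm_nonneg s _) q
  calc ∑ k ∈ Finset.range K, recentSteps r s k ^ (q + 1)
      ≤ ∑ k ∈ Finset.range K, (r : ℝ) ^ q *
          ∑ i ∈ Finset.range r, stepNorm s (k - (i : ℕ)) ^ (q + 1) :=
        Finset.sum_le_sum fun k _ => hpow k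
    _ = (r : ℝ) ^ q * ∑ i ∈ Finset.range r,
          ∑ k ∈ Finset.range K, stepNorm s (k - (i : ℕ)) ^ (q + 1) := by
        rw [← Finset.mul_sum, Finset.sum_comm]
    _ ≤ (r : ℝ) ^ q * ∑ _i ∈ Finset.range r, (r + ∑ k ∈ Finset.range K, ‖s k‖ ^ (q + 1)) := by
        gcongr with i hi
        refine (sum_stepNorm_shift_pow_le s (q + 1) K i).trans ?_
        gcongr
        exact (Finset.mem_range.1 hi).le
    _ = (r : ℝ) ^ (q + 1) * (r + ∑ k ∈ Finset.range K, ‖s k‖ ^ (q + 1)) := by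
        rw [Finset.sum_const, Finset.card_range, nsmul_eq_mul]
        ring

end RecentSteps

section CompoundGrowth

variable {a σ : ℕ → ℝ} {K : ℕ}

theorem compound_pos (ha : ∀ k, 0 ≤ a k) (h0 : 0 < σ 0)
    (hσ : ∀ k < K, σ (k + 1) = σ k + σ k * a k) {k : ℕ} (hk : k ≤ K) : 0 < σ k := by
  induction k with
  | zero => exact h0
  | succ k ih =>
    rw [hσ k hk]
    exact add_pos_of_pos_of_nonneg (ih (by omega)) (mul_nonneg (ih (by omega)).le (ha k))

theorem compound_mono (ha : ∀ k, 0 ≤ a k) (h0 : 0 < σ 0)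
    (hσ : ∀ k < K, σ (k + 1) = σ k + σ k * a k) {j k : ℕ} (hjk : j ≤ k) (hk : k ≤ K) :
    σ j ≤ σ k := by
  induction k, hjk using Nat.le_induction with
  | base => exact le_rfl
  | succ k _ ih =>
    rw [hσ k hk]
    exact (ih (by omega)).trans
      (le_add_of_nonneg_right (mul_nonneg (compound_pos ha h0 hσ (by omega)).le (ha k)))

theorem sum_le_compound_div (ha : ∀ k, 0 ≤ a k) (h0 : 0 < σ 0)
    (hσ : ∀ k < K, σ (k + 1) = σ k + σ k * a k) {k : ℕ} (hk : k ≤ K) :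
    ∑ j ∈ Finset.range k, a j ≤ (σ k - σ 0) / σ 0 := by
  rw [le_div_iff₀' h0]
  induction k with
  | zero => simp
  | succ k ih =>
    have hgrow : σ 0 * a k ≤ σ k * a k :=
      mul_le_mul_of_nonneg_right (compound_mono ha h0 hσ k.zero_le (by omega)) (ha k)
    rw [Finset.sum_range_succ, mul_add, hσ k hk]
    linarith [ih (by omega)]

theorem mul_sum_le_compound {C A : ℝ} (ha : ∀ k, 0 ≤ a k) (h0 : 0 < σ 0)
    (hσ : ∀ k < K, σ (k + 1) = σ k + σ k * a k) (hC : 0 ≤ C) (hA : 0 ≤ A)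
    (hstep : ∀ k < K, σ k ≤ 2 * C → a k ≤ A) {k : ℕ} (hk : k ≤ K) :
    C * ∑ j ∈ Finset.range k, a j ≤ (σ k - σ 0) / 2 + C * (2 * C / σ 0 + A) := by
  induction k with
  | zero =>
    rw [Finset.range_zero, Finset.sum_empty, mul_zero, sub_self, zero_div, zero_add]
    positivity
  | succ k ih =>
    rcases le_or_gt (σ k) (2 * C) with h | h
    · have hmono := compound_mono ha h0 hσ (k + 1).zero_le hk
      have hsum : ∑ j ∈ Finset.range (k + 1), a j ≤ 2 * C / σ 0 + A := by
        rw [Finset.sum_range_succ]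
        refine add_le_add ((sum_le_compound_div ha h0 hσ (by omega)).trans ?_) (hstep k hk h)
        gcongr
        linarith
      linarith [mul_le_mul_of_nonneg_left hsum hC]
    · -- Beyond the threshold `σ` grows at least twice as fast as `C * ∑ a`.
      have hfast : 2 * C * a k ≤ σ k * a k := mul_le_mul_of_nonneg_right h.le (ha k)
      rw [Finset.sum_range_succ, mul_add, hσ k hk]
      linarith [ih (by omega)]

theorem compound_le_of_growth_le {B C A : ℝ} (ha : ∀ k, 0 ≤ a k) (h0 : 0 < σ 0)
    (hσ : ∀ k < K, σ (k + 1) = σ k + σ k * a k) (hC : 0 ≤ C) (hA : 0 ≤ A)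
    (hstep : ∀ k < K, σ k ≤ 2 * C → a k ≤ A)
    (hgrowth : σ K - σ 0 ≤ B + C * ∑ k ∈ Finset.range K, a k) :
    σ K ≤ σ 0 + 2 * B + 2 * (C * (2 * C / σ 0 + A)) := by
  linarith [mul_sum_le_compound ha h0 hσ hC hA hstep le_rfl]

end CompoundGrowth

section StepTests

variable {n p : ℕ} {θ₁ θ₂ f₀ L σ : ℝ} {f : E n → ℝ} {x s : E n} {J : Jet n} {T : Tensor n p}

theorem StepAccepted.regularization_le (hs : StepAccepted θ₁ θ₂ f₀ J T σ s) (hp : p ≠ 0) :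
    σ / ((p + 1)! : ℝ) * ‖s‖ ^ (p + 1) ≤ f₀ - approxTaylor f₀ J T s := by
  have hdec := hs.decrease
  simp only [model, approxTaylor_zero _ _ _ hp, norm_zero, zero_pow p.succ_ne_zero, mul_zero,
    add_zero] at hdec
  linarith

theorem StepAccepted.mul_norm_pow_le (hp : p ≠ 0)
    (hs : StepAccepted θ₁ θ₂ (f x) (derivOracle p f x) T σ s) (hf : ContDiff ℝ p f) (hL : 0 ≤ L)
    (hlip : ∀ x y, ‖iteratedFDeriv ℝ p f x - iteratedFDeriv ℝ p f y‖ ≤ L * ‖x - y‖)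
    (hT : symmetrize T = T) :
    σ * ‖s‖ ^ (p + 1) ≤ ((p + 1)! : ℝ) *
      (f x - f (x + s) + (L * ‖s‖ + ‖T - iteratedFDeriv ℝ p f x‖) * ‖s‖ ^ p) := by
  have htaylor := norm_iteratedFDeriv_sub_approxTaylor_le hp hf hL hlip hT x s (Nat.zero_le p)
  rw [Nat.sub_zero] at htaylor
  have heval := (iteratedFDeriv ℝ 0 f (x + s)
    - iteratedFDeriv ℝ 0 (approxTaylor (f x) (derivOracle p f x) T) s).le_opNorm 0
  simp only [_root_.sub_apply, iteratedFDeriv_zero_apply, Finset.univ_eq_empty,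
    Finset.prod_empty, mul_one, Real.norm_eq_abs] at heval
  have hfac : (0 : ℝ) < (p + 1)! := by exact_mod_cast (p + 1).factorial_pos
  rw [← div_le_iff₀' hfac, ← div_mul_eq_mul_div]
  linarith [hs.regularization_le hp, (abs_le.1 (heval.trans htaylor)).2]

theorem StepAccepted.norm_gradient_le (hp : p ≠ 0)
    (hs : StepAccepted θ₁ θ₂ (f x) (derivOracle p f x) T σ s) (hσ : 0 ≤ σ) (hθ₁ : 0 ≤ θ₁)
    (hf : ContDiff ℝ p f) (hL : 0 ≤ L)
    (hlip : ∀ x y, ‖iteratedFDeriv ℝ p f x - iteratedFDeriv ℝ p f y‖ ≤ L * ‖x - y‖)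
    (hT : symmetrize T = T) :
    ‖gradient f (x + s)‖ ≤ θ₁ * σ * ‖s‖ ^ p
      + (L * ‖s‖ + ‖T - iteratedFDeriv ℝ p f x‖) * ‖s‖ ^ (p - 1) := by
  have hmodel := hs.gradient_small.trans
    (div_le_self (by positivity) (by exact_mod_cast p.factorial_pos))
  rw [norm_gradient] at hmodel ⊢
  exact (norm_le_norm_add_norm_sub' _ _).trans (add_le_add hmodel
    (norm_iteratedFDeriv_sub_approxTaylor_le hp hf hL hlip hT x s (Nat.pos_of_ne_zero hp)))

theorem StepAccepted.neg_lambdaMin_hessian_le [NeZero n] (hp : 2 ≤ p)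
    (hs : StepAccepted θ₁ θ₂ (f x) (derivOracle p f x) T σ s) (hσ : 0 ≤ σ) (hθ₂ : 0 ≤ θ₂)
    (hf : ContDiff ℝ p f) (hL : 0 ≤ L)
    (hlip : ∀ x y, ‖iteratedFDeriv ℝ p f x - iteratedFDeriv ℝ p f y‖ ≤ L * ‖x - y‖)
    (hT : symmetrize T = T) :
    -lambdaMin (hessian f (x + s)) ≤ θ₂ * σ * ‖s‖ ^ (p - 1)
      + (L * ‖s‖ + ‖T - iteratedFDeriv ℝ p f x‖) * ‖s‖ ^ (p - 2) := by
  have hmodel := ((le_max_right _ _).trans hs.curvature_small).trans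
    (div_le_self (by positivity) (by exact_mod_cast (p - 1).factorial_pos))
  have htaylor := norm_iteratedFDeriv_sub_approxTaylor_le (by omega) hf hL hlip hT x s hp
  linarith [lambdaMin_hessian_sub_le (hf.of_le (by exact_mod_cast hp))
    (contDiff_approxTaylor (f x) (derivOracle p f x) T) (x + s) s]

theorem neg_mul_pow_le_div_factorial {M ρ t : ℝ} {i p : ℕ} (hM : 0 ≤ M) (hρ : 1 ≤ ρ)
    (hip : i ≤ p) (ht : -(M * ρ ^ i) ≤ t) : -(M * ρ ^ p) ≤ 1 / (i ! : ℝ) * t := by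
  have hfac : 1 / (i ! : ℝ) ≤ 1 :=
    div_le_one_of_le₀ (by exact_mod_cast i.factorial_pos) (Nat.cast_nonneg _)
  have hnonneg : 0 ≤ M * ρ ^ i := by positivity
  calc -(M * ρ ^ p) ≤ -(M * ρ ^ i) := neg_le_neg (by gcongr)
    _ ≤ 1 / (i ! : ℝ) * -(M * ρ ^ i) := by
        rw [mul_neg]
        exact neg_le_neg (mul_le_of_le_one_left hnonneg hfac)
    _ ≤ 1 / (i ! : ℝ) * t := by gcongr

theorem StepAccepted.norm_le {M σ₀ : ℝ} (hp : p ≠ 0) (hs : StepAccepted θ₁ θ₂ f₀ J T σ s)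
    (hσ₀ : 0 < σ₀) (hσ : σ₀ ≤ σ) (hM : 0 ≤ M)
    (hJ : ∀ i ∈ Finset.Icc 1 (p - 1), -(M * ‖s‖ ^ i) ≤ J i fun _ => s)
    (hT : -(M * ‖s‖ ^ p) ≤ T fun _ => s) :
    ‖s‖ ≤ 1 + ((p + 1)! : ℝ) * p * M / σ₀ := by
  have hbound : 0 ≤ ((p + 1)! : ℝ) * p * M / σ₀ := by positivity
  rcases le_total ‖s‖ 1 with hsmall | hlarge
  · linarith
  have hsum : -(((p - 1 : ℕ) : ℝ) * (M * ‖s‖ ^ p))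
      ≤ ∑ i ∈ Finset.Icc 1 (p - 1), 1 / (i ! : ℝ) * J i fun _ => s := by
    have h := Finset.card_nsmul_le_sum _ (fun i => 1 / (i ! : ℝ) * J i fun _ => s) _ fun i hi =>
      neg_mul_pow_le_div_factorial hM hlarge
        ((Finset.mem_Icc.1 hi).2.trans (Nat.sub_le p 1)) (hJ i hi)
    rwa [Nat.card_Icc, nsmul_eq_mul, Nat.add_sub_cancel, mul_neg] at h
  have htop := neg_mul_pow_le_div_factorial hM hlarge le_rfl hT
  have hmodel := hs.regularization_le hp
  rw [approxTaylor] at hmodel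
  rw [Nat.cast_pred (Nat.pos_of_ne_zero hp)] at hsum
  have hquot : σ / ((p + 1)! : ℝ) * ‖s‖ ≤ p * M := by
    refine le_of_mul_le_mul_right ?_ (by positivity : 0 < ‖s‖ ^ p)
    rw [mul_assoc, ← pow_succ']
    linarith
  have hmul : σ₀ * ‖s‖ ≤ ((p + 1)! : ℝ) * p * M := by
    rw [div_mul_eq_mul_div, div_le_iff₀' (by exact_mod_cast (p + 1).factorial_pos)] at hquot
    linarith [mul_le_mul_of_nonneg_right hσ (norm_nonneg s)]
  linarith [(le_div_iff₀' hσ₀).2 hmul]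

end StepTests

section DerivativeBounds

variable {n p : ℕ}

theorem neg_mul_norm_pow_le_diagonal {r : ℕ} (M : Tensor n r) {c : ℝ} (hr : r ≠ 0)
    (h : ∀ d : E n, ‖d‖ ≤ 1 → -c ≤ M fun _ => d) (s : E n) :
    -(c * ‖s‖ ^ r) ≤ M fun _ => s := by
  rcases eq_or_ne s 0 with rfl | hs
  · rw [norm_zero, zero_pow hr, mul_zero, neg_zero,
      M.map_coord_zero (⟨0, Nat.pos_of_ne_zero hr⟩ : Fin r) rfl]
  have hs' : ‖s‖ ≠ 0 := norm_ne_zero_iff.2 hs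
  have hunit := h (‖s‖⁻¹ • s) (by rw [norm_smul, norm_inv, norm_norm, inv_mul_cancel₀ hs'])
  have hscale : (M fun _ => s) = ‖s‖ ^ r * M fun _ => ‖s‖⁻¹ • s := by
    simpa [smul_smul, hs'] using M.map_smul_univ (fun _ => ‖s‖) fun _ => ‖s‖⁻¹ • s
  rw [hscale, mul_comm c, ← mul_neg]
  gcongr

theorem abs_diagonal_le {r : ℕ} (M : Tensor n r) (s : E n) :
    |M fun _ => s| ≤ ‖M‖ * ‖s‖ ^ r := by
  simpa using M.le_opNorm fun _ => s

variable {f : E n → ℝ} {flow L κhigh κp : ℝ}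

theorem ProblemAssumptions.lipschitzConst_nonneg [NeZero n]
    (hf : ProblemAssumptions p f flow L κhigh κp) : 0 ≤ L := by
  simpa [e] using (norm_nonneg _).trans (hf.lipschitz (e 0) 0)

theorem ProblemAssumptions.iteratedFDeriv_diagonal_ge [NeZero n] {G B : ℝ} (hp : 2 ≤ p)
    (hf : ProblemAssumptions p f flow L κhigh κp) {x : E n} (hG : ‖gradient f x‖ ≤ G)
    (hB : -lambdaMin (hessian f x) ≤ B) (hB0 : 0 ≤ B) (s : E n) {i : ℕ} (hi : 1 ≤ i)
    (hip : i ≤ p) :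
    -((G + B + |κhigh| + |κp|) * ‖s‖ ^ i) ≤ iteratedFDeriv ℝ i f x fun _ => s := by
  have hG0 : 0 ≤ G := (norm_nonneg _).trans hG
  have hκhigh := abs_nonneg κhigh
  have hκp := abs_nonneg κp
  suffices h : ∃ c ≤ G + B + |κhigh| + |κp|,
      -(c * ‖s‖ ^ i) ≤ iteratedFDeriv ℝ i f x fun _ => s by
    obtain ⟨c, hc, h⟩ := h
    exact (neg_le_neg (by gcongr)).trans h
  rcases (by omega : i = 1 ∨ i = 2 ∨ (3 ≤ i ∧ i ≤ p - 1) ∨ (3 ≤ i ∧ i = p)) with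
    rfl | rfl | ⟨h3, hip'⟩ | ⟨h3, rfl⟩
  · refine ⟨‖gradient f x‖, by linarith, neg_le_of_abs_le ?_⟩
    rw [norm_gradient]
    exact abs_diagonal_le _ s
  · refine ⟨B, by linarith, ?_⟩
    rw [← neg_mul]
    exact (le_lambdaMin_hessian_iff (hf.contDiff.of_le (by exact_mod_cast hp)) x (-B)).1
      (neg_le.1 hB) s
  · refine ⟨|κhigh|, by linarith, neg_mul_norm_pow_le_diagonal _ (by omega) (fun d hd => ?_) s⟩
    exact (neg_le_neg (le_abs_self _)).trans (hf.intermediate i h3 hip' x d hd)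
  · refine ⟨‖iteratedFDeriv ℝ i f x‖, ?_, neg_le_of_abs_le (abs_diagonal_le _ s)⟩
    linarith [hf.top_bounded h3 x, le_abs_self κp]

end DerivativeBounds

section Runs

variable {n p m N : ℕ} {σ₀ θ₁ θ₂ flow L κhigh κp : ℝ} {f : E n → ℝ} {x₀ : E n}
  {x s : ℕ → E n} {σ : ℕ → ℝ} {T : ℕ → Tensor n p}

theorem IsRun.of_le (hrun : IsRun m σ₀ θ₁ θ₂ f x₀ N x s σ T) {K : ℕ} (hK : K ≤ N) :
    IsRun m σ₀ θ₁ θ₂ f x₀ K x s σ T where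
  x_zero := hrun.x_zero
  σ_zero := hrun.σ_zero
  fdStep_pos k hk := hrun.fdStep_pos k (hk.trans_le hK)
  tensor k hk := hrun.tensor k (hk.trans_le hK)
  step k hk := hrun.step k (hk.trans_le hK)
  x_succ k hk := hrun.x_succ k (hk.trans_le hK)
  σ_succ k hk := hrun.σ_succ k (hk.trans_le hK)

theorem IsRun.stepAccepted (hrun : IsRun m σ₀ θ₁ θ₂ f x₀ N x s σ T) {k : ℕ} (hk : k < N) :
    StepAccepted θ₁ θ₂ (f (x k)) (derivOracle p f (x k)) (T k) (σ k) (s k) := by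
  simpa only [result_runIteration] using hrun.step k hk

theorem IsRun.tensor_of_mod_eq_zero (hrun : IsRun m σ₀ θ₁ θ₂ f x₀ N x s σ T) {k : ℕ} (hk : k < N)
    (hkm : k % m = 0) :
    T k = symmetrize (fdTensor (fdStep m s k) (derivOracle p f (x k))
      (fun i => derivOracle p f (x k + fdStep m s k • e i)) p) := by
  rw [hrun.tensor k hk, result_runIteration, if_pos hkm]

theorem IsRun.tensor_of_mod_ne_zero (hrun : IsRun m σ₀ θ₁ θ₂ f x₀ N x s σ T) {k : ℕ} (hk : k < N)
    (hkm : k % m ≠ 0) : T k = T (k - 1) := by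
  rw [hrun.tensor k hk, result_runIteration, if_neg hkm]

theorem IsRun.symmetrize_tensor (hrun : IsRun m σ₀ θ₁ θ₂ f x₀ N x s σ T) {k : ℕ} (hk : k < N) :
    symmetrize (T k) = T k := by
  induction k with
  | zero => rw [hrun.tensor_of_mod_eq_zero hk (Nat.zero_mod m), symmetrize_symmetrize]
  | succ k ih =>
    by_cases hkm : (k + 1) % m = 0
    · rw [hrun.tensor_of_mod_eq_zero hk hkm, symmetrize_symmetrize]
    · rw [hrun.tensor_of_mod_ne_zero hk hkm]
      exact ih (by omega)

theorem IsRun.norm_tensor_sub_le_of_mod [NeZero n] (hp : 2 ≤ p)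
    (hf : ProblemAssumptions p f flow L κhigh κp)
    (hrun : IsRun m σ₀ θ₁ θ₂ f x₀ N x s σ T)
    (hpos : ∀ k < N, k % m = 0 → 0 < fdStep m s k) {k : ℕ} (hk : k < N) :
    ‖T k - iteratedFDeriv ℝ p f (x k)‖ ≤ L * recentSteps (m + k % m) s (k - 1) := by
  have hL := hf.lipschitzConst_nonneg
  have hrefresh : ∀ k < N, k % m = 0 →
      ‖T k - iteratedFDeriv ℝ p f (x k)‖ ≤ L * recentSteps (m + k % m) s (k - 1) := by
    intro k hk hkm
    rw [hrun.tensor_of_mod_eq_zero hk hkm, hkm, Nat.add_zero]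
    exact (norm_symmetrize_fdTensor_sub_le hp hf.contDiff hL hf.lipschitz (hpos k hk hkm) _).trans
      (mul_le_mul_of_nonneg_left (sqrt_mul_fdStep_le m s k) hL)
  induction k with
  | zero => exact hrefresh 0 hk (Nat.zero_mod m)
  | succ k ih =>
    by_cases hkm : (k + 1) % m = 0
    · exact hrefresh _ hk hkm
    have hmod : m + (k + 1) % m = m + k % m + 1 := by
      have hdiv := Nat.succ_div_of_not_dvd (mt Nat.mod_eq_zero_of_dvd hkm)
      have hk1 := Nat.div_add_mod (k + 1) m
      rw [hdiv] at hk1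
      linarith [Nat.div_add_mod k m]
    have hmove := hf.lipschitz (x k) (x (k + 1))
    rw [hrun.x_succ k (by omega), sub_add_cancel_left, norm_neg] at hmove
    rw [hrun.tensor_of_mod_ne_zero hk hkm, Nat.add_sub_cancel, hmod, recentSteps_succ,
      Nat.cast_succ, add_sub_cancel_right, stepNorm_natCast, mul_add, hrun.x_succ k (by omega)]
    exact (norm_sub_le_norm_sub_add_norm_sub _ _ _).trans (add_le_add (ih (by omega)) hmove)

theorem IsRun.norm_tensor_sub_le [NeZero n] (hp : 2 ≤ p) (hm : 0 < m)
    (hf : ProblemAssumptions p f flow L κhigh κp)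
    (hrun : IsRun m σ₀ θ₁ θ₂ f x₀ N x s σ T)
    (hpos : ∀ k < N, k % m = 0 → 0 < fdStep m s k) {k : ℕ} (hk : k < N) :
    ‖T k - iteratedFDeriv ℝ p f (x k)‖ ≤ L * recentSteps (2 * m) s (k - 1) := by
  have hage : m + k % m ≤ 2 * m := by linarith [Nat.mod_lt k hm]
  exact (hrun.norm_tensor_sub_le_of_mod hp hf hpos hk).trans
    (mul_le_mul_of_nonneg_left (recentSteps_mono s _ hage) hf.lipschitzConst_nonneg)

theorem IsRun.taylorError_le [NeZero n] (hp : 2 ≤ p) (hm : 0 < m)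
    (hf : ProblemAssumptions p f flow L κhigh κp)
    (hrun : IsRun m σ₀ θ₁ θ₂ f x₀ N x s σ T)
    (hpos : ∀ k < N, k % m = 0 → 0 < fdStep m s k) {k : ℕ} (hk : k < N) (j : ℕ) :
    (L * ‖s k‖ + ‖T k - iteratedFDeriv ℝ p f (x k)‖) * ‖s k‖ ^ j
      ≤ L * recentSteps (2 * m + 1) s k ^ (j + 1) := by
  have hL := hf.lipschitzConst_nonneg
  have hcoeff : L * ‖s k‖ + ‖T k - iteratedFDeriv ℝ p f (x k)‖
      ≤ L * recentSteps (2 * m + 1) s k := by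
    rw [recentSteps_succ, stepNorm_natCast, mul_add, add_comm]
    exact add_le_add_left (hrun.norm_tensor_sub_le hp hm hf hpos hk) _
  have hW := recentSteps_nonneg (2 * m + 1) s k
  calc (L * ‖s k‖ + ‖T k - iteratedFDeriv ℝ p f (x k)‖) * ‖s k‖ ^ j
      ≤ L * recentSteps (2 * m + 1) s k * recentSteps (2 * m + 1) s k ^ j := by
        gcongr
        exact norm_le_recentSteps _ s k
    _ = L * recentSteps (2 * m + 1) s k ^ (j + 1) := by rw [mul_assoc, ← pow_succ']

theorem IsRun.σ_pos (hrun : IsRun m σ₀ θ₁ θ₂ f x₀ N x s σ T) (hσ₀ : 0 < σ₀) {k : ℕ}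
    (hk : k ≤ N) : 0 < σ k :=
  compound_pos (a := fun k => ‖s k‖ ^ (p + 1)) (fun _ => by positivity)
    (hrun.σ_zero ▸ hσ₀) hrun.σ_succ hk

theorem IsRun.σ_mono (hrun : IsRun m σ₀ θ₁ θ₂ f x₀ N x s σ T) (hσ₀ : 0 < σ₀) {j k : ℕ}
    (hjk : j ≤ k) (hk : k ≤ N) : σ j ≤ σ k :=
  compound_mono (a := fun k => ‖s k‖ ^ (p + 1)) (fun _ => by positivity)
    (hrun.σ_zero ▸ hσ₀) hrun.σ_succ hjk hk

theorem IsRun.le_σ (hrun : IsRun m σ₀ θ₁ θ₂ f x₀ N x s σ T) (hσ₀ : 0 < σ₀) {k : ℕ}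
    (hk : k ≤ N) : σ₀ ≤ σ k :=
  hrun.σ_zero ▸ hrun.σ_mono hσ₀ k.zero_le hk

theorem IsRun.sum_norm_pow_le (hrun : IsRun m σ₀ θ₁ θ₂ f x₀ N x s σ T) (hσ₀ : 0 < σ₀) {k : ℕ}
    (hk : k ≤ N) : ∑ j ∈ Finset.range k, ‖s j‖ ^ (p + 1) ≤ σ k / σ₀ := by
  have h := sum_le_compound_div (a := fun k => ‖s k‖ ^ (p + 1)) (fun _ => by positivity)
    (hrun.σ_zero ▸ hσ₀) hrun.σ_succ hk
  rw [hrun.σ_zero] at h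
  exact h.trans (by gcongr; linarith)

theorem IsRun.mul_norm_pow_le [NeZero n] (hp : 2 ≤ p) (hm : 0 < m)
    (hf : ProblemAssumptions p f flow L κhigh κp)
    (hrun : IsRun m σ₀ θ₁ θ₂ f x₀ N x s σ T)
    (hpos : ∀ k < N, k % m = 0 → 0 < fdStep m s k) {k : ℕ} (hk : k < N) :
    σ k * ‖s k‖ ^ (p + 1) ≤ ((p + 1)! : ℝ) *
      (f (x k) - f (x (k + 1)) + L * recentSteps (2 * m + 1) s k ^ (p + 1)) := by
  rw [hrun.x_succ k hk]
  refine ((hrun.stepAccepted hk).mul_norm_pow_le (by omega) hf.contDiff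
    hf.lipschitzConst_nonneg hf.lipschitz (hrun.symmetrize_tensor hk)).trans ?_
  have htaylor := hrun.taylorError_le hp hm hf hpos hk p
  gcongr

theorem IsRun.norm_gradient_succ_le [NeZero n] (hp : 2 ≤ p) (hm : 0 < m) (hσ₀ : 0 < σ₀)
    (hθ₁ : 0 ≤ θ₁) (hf : ProblemAssumptions p f flow L κhigh κp)
    (hrun : IsRun m σ₀ θ₁ θ₂ f x₀ N x s σ T)
    (hpos : ∀ k < N, k % m = 0 → 0 < fdStep m s k) {k : ℕ} (hk : k < N) :
    ‖gradient f (x (k + 1))‖ ≤ (θ₁ * σ k + L) * recentSteps (2 * m + 1) s k ^ p := by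
  have hσ := (hrun.σ_pos hσ₀ hk.le).le
  have htaylor := hrun.taylorError_le hp hm hf hpos hk (p - 1)
  rw [Nat.sub_add_cancel (by omega)] at htaylor
  rw [hrun.x_succ k hk, add_mul]
  refine ((hrun.stepAccepted hk).norm_gradient_le (by omega) hσ hθ₁ hf.contDiff
    hf.lipschitzConst_nonneg hf.lipschitz (hrun.symmetrize_tensor hk)).trans
    (add_le_add ?_ htaylor)
  gcongr
  exact norm_le_recentSteps _ s k

theorem IsRun.neg_lambdaMin_hessian_succ_le [NeZero n] (hp : 2 ≤ p) (hm : 0 < m) (hσ₀ : 0 < σ₀)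
    (hθ₂ : 0 ≤ θ₂) (hf : ProblemAssumptions p f flow L κhigh κp)
    (hrun : IsRun m σ₀ θ₁ θ₂ f x₀ N x s σ T)
    (hpos : ∀ k < N, k % m = 0 → 0 < fdStep m s k) {k : ℕ} (hk : k < N) :
    -lambdaMin (hessian f (x (k + 1)))
      ≤ (θ₂ * σ k + L) * recentSteps (2 * m + 1) s k ^ (p - 1) := by
  have hσ := (hrun.σ_pos hσ₀ hk.le).le
  have htaylor := hrun.taylorError_le hp hm hf hpos hk (p - 2)
  rw [(by omega : p - 2 + 1 = p - 1)] at htaylor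
  rw [hrun.x_succ k hk, add_mul]
  refine ((hrun.stepAccepted hk).neg_lambdaMin_hessian_le hp hσ hθ₂ hf.contDiff
    hf.lipschitzConst_nonneg hf.lipschitz (hrun.symmetrize_tensor hk)).trans
    (add_le_add ?_ htaylor)
  gcongr
  exact norm_le_recentSteps _ s k

end Runs

section RegularizationBound

/-- The factor of `∑ ‖s_k‖^{p+1}` in the upper bound on the growth of `σ`. -/
noncomputable def growthFactor (p m : ℕ) (L : ℝ) : ℝ :=
  ((p + 1)! : ℝ) * (L * ((2 * m + 1 : ℕ) : ℝ) ^ (p + 1))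

/-- A bound on the sum of `2 m + 1` past step lengths, valid as long as `σ ≤ V`. -/
noncomputable def pastStepsBound (m : ℕ) (σ₀ V : ℝ) : ℝ := ((2 * m + 1 : ℕ) : ℝ) * (1 + V / σ₀)

/-- A one-sided bound on all coefficients of the inexact Taylor polynomial, valid as long as
`σ ≤ V`. The successive groups of terms account for the gradient, the Hessian, the orders
`3, …, p - 1`, the order `p` and the finite-difference error. -/
noncomputable def coeffBound (p m : ℕ) (σ₀ θ₁ θ₂ L κhigh κp G B V : ℝ) : ℝ :=
  (G + (θ₁ * V + L) * pastStepsBound m σ₀ V ^ p)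
    + (B + (θ₂ * V + L) * pastStepsBound m σ₀ V ^ (p - 1)) + |κhigh| + |κp|
    + L * pastStepsBound m σ₀ V

/-- A bound on the length of the steps taken while `σ ≤ V`. -/
noncomputable def stepBound (p m : ℕ) (σ₀ θ₁ θ₂ L κhigh κp G B V : ℝ) : ℝ :=
  1 + ((p + 1)! : ℝ) * p * coeffBound p m σ₀ θ₁ θ₂ L κhigh κp G B V / σ₀

/-- A bound on `σ` along a whole run; it does not involve the dimension. -/
noncomputable def σMax (p m : ℕ) (σ₀ θ₁ θ₂ L κhigh κp Δ G B : ℝ) : ℝ :=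
  σ₀ + 2 * (((p + 1)! : ℝ) * Δ + growthFactor p m L * (2 * m + 1 : ℕ))
    + 2 * (growthFactor p m L * (2 * growthFactor p m L / σ₀
      + stepBound p m σ₀ θ₁ θ₂ L κhigh κp G B (2 * growthFactor p m L) ^ (p + 1)))

variable {n p m N : ℕ} {σ₀ θ₁ θ₂ flow L κhigh κp Δ G B V : ℝ} {f : E n → ℝ} {x₀ : E n}
  {x s : ℕ → E n} {σ : ℕ → ℝ} {T : ℕ → Tensor n p}

theorem growthFactor_nonneg (hL : 0 ≤ L) : 0 ≤ growthFactor p m L := by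
  unfold growthFactor
  positivity

theorem pastStepsBound_nonneg (hσ₀ : 0 < σ₀) (hV : 0 ≤ V) : 0 ≤ pastStepsBound m σ₀ V := by
  unfold pastStepsBound
  positivity

theorem coeffBound_nonneg (hσ₀ : 0 < σ₀) (hθ₁ : 0 ≤ θ₁) (hθ₂ : 0 ≤ θ₂) (hL : 0 ≤ L)
    (hG : 0 ≤ G) (hB : 0 ≤ B) (hV : 0 ≤ V) :
    0 ≤ coeffBound p m σ₀ θ₁ θ₂ L κhigh κp G B V := by
  have := pastStepsBound_nonneg (m := m) hσ₀ hV
  unfold coeffBound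
  positivity

theorem stepBound_nonneg (hσ₀ : 0 < σ₀) (hθ₁ : 0 ≤ θ₁) (hθ₂ : 0 ≤ θ₂) (hL : 0 ≤ L)
    (hG : 0 ≤ G) (hB : 0 ≤ B) (hV : 0 ≤ V) :
    0 ≤ stepBound p m σ₀ θ₁ θ₂ L κhigh κp G B V := by
  have := coeffBound_nonneg (p := p) (m := m) (κhigh := κhigh) (κp := κp) hσ₀ hθ₁ hθ₂ hL hG hB hV
  unfold stepBound
  positivity

theorem IsRun.σ_sub_le [NeZero n] (hp : 2 ≤ p) (hm : 0 < m)
    (hf : ProblemAssumptions p f flow L κhigh κp)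
    (hrun : IsRun m σ₀ θ₁ θ₂ f x₀ N x s σ T)
    (hpos : ∀ k < N, k % m = 0 → 0 < fdStep m s k) (hΔ : f x₀ - flow ≤ Δ) :
    σ N - σ₀ ≤ ((p + 1)! : ℝ) * Δ + growthFactor p m L * (2 * m + 1 : ℕ)
      + growthFactor p m L * ∑ k ∈ Finset.range N, ‖s k‖ ^ (p + 1) := by
  have hL := hf.lipschitzConst_nonneg
  have htele : ∀ k ≤ N, σ k - σ₀ ≤ ((p + 1)! : ℝ) * (f x₀ - f (x k)
      + L * ∑ j ∈ Finset.range k, recentSteps (2 * m + 1) s j ^ (p + 1)) := by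
    intro k hk
    induction k with
    | zero => simp [hrun.x_zero, hrun.σ_zero]
    | succ k ih =>
      rw [hrun.σ_succ k hk, Finset.sum_range_succ]
      linarith [hrun.mul_norm_pow_le hp hm hf hpos hk, ih (by omega)]
  calc σ N - σ₀ ≤ ((p + 1)! : ℝ) * (f x₀ - f (x N)
        + L * ∑ j ∈ Finset.range N, recentSteps (2 * m + 1) s j ^ (p + 1)) := htele N le_rfl
    _ ≤ ((p + 1)! : ℝ) * (Δ + L * (((2 * m + 1 : ℕ) : ℝ) ^ (p + 1)
          * ((2 * m + 1 : ℕ) + ∑ k ∈ Finset.range N, ‖s k‖ ^ (p + 1)))) := by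
        gcongr
        · linarith [hf.lower_bound (x N)]
        · exact sum_recentSteps_pow_le _ p s N
    _ = _ := by
        rw [growthFactor]
        ring

theorem IsRun.norm_step_le_of_lt (hrun : IsRun m σ₀ θ₁ θ₂ f x₀ N x s σ T) (hσ₀ : 0 < σ₀)
    {k : ℕ} (hk : k ≤ N) (hσV : σ k ≤ V) {j : ℕ} (hj : j < k) : ‖s j‖ ≤ 1 + V / σ₀ := by
  have hpow : ‖s j‖ ^ (p + 1) ≤ V / σ₀ :=
    calc ‖s j‖ ^ (p + 1) ≤ ∑ i ∈ Finset.range k, ‖s i‖ ^ (p + 1) :=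
          Finset.single_le_sum (f := fun i => ‖s i‖ ^ (p + 1)) (fun _ _ => by positivity)
            (Finset.mem_range.2 hj)
      _ ≤ σ k / σ₀ := hrun.sum_norm_pow_le hσ₀ hk
      _ ≤ V / σ₀ := by gcongr
  rcases le_total ‖s j‖ 1 with h | h
  · linarith [pow_nonneg (norm_nonneg (s j)) (p + 1)]
  · have hself : ‖s j‖ ≤ ‖s j‖ ^ (p + 1) := le_self_pow₀ h (by omega)
    linarith

theorem IsRun.recentSteps_le_pastStepsBound (hrun : IsRun m σ₀ θ₁ θ₂ f x₀ N x s σ T)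
    (hσ₀ : 0 < σ₀) {k : ℕ} (hk : k ≤ N) (hσV : σ k ≤ V) {j : ℤ} (hj : j < k) :
    recentSteps (2 * m + 1) s j ≤ pastStepsBound m σ₀ V := by
  have hV : 0 ≤ V := (hrun.σ_pos hσ₀ hk).le.trans hσV
  exact recentSteps_le_mul (le_add_of_nonneg_right (by positivity))
    (fun i hi => hrun.norm_step_le_of_lt hσ₀ hk hσV hi) _ hj

theorem IsRun.norm_gradient_le [NeZero n] (hp : 2 ≤ p) (hm : 0 < m) (hσ₀ : 0 < σ₀)
    (hθ₁ : 0 ≤ θ₁) (hf : ProblemAssumptions p f flow L κhigh κp)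
    (hrun : IsRun m σ₀ θ₁ θ₂ f x₀ N x s σ T)
    (hpos : ∀ k < N, k % m = 0 → 0 < fdStep m s k) (hG : ‖gradient f x₀‖ ≤ G)
    {k : ℕ} (hk : k ≤ N) (hσV : σ k ≤ V) :
    ‖gradient f (x k)‖ ≤ G + (θ₁ * V + L) * pastStepsBound m σ₀ V ^ p := by
  have hL := hf.lipschitzConst_nonneg
  have hV : 0 ≤ V := (hrun.σ_pos hσ₀ hk).le.trans hσV
  have hW := pastStepsBound_nonneg (m := m) hσ₀ hV
  cases k with
  | zero =>
    rw [hrun.x_zero]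
    exact hG.trans (le_add_of_nonneg_right (by positivity))
  | succ j =>
    have hσj := (hrun.σ_mono hσ₀ j.le_succ hk).trans hσV
    have hWj := hrun.recentSteps_le_pastStepsBound hσ₀ hk hσV (j := j) (by omega)
    have hWj0 := recentSteps_nonneg (2 * m + 1) s j
    refine ((hrun.norm_gradient_succ_le hp hm hσ₀ hθ₁ hf hpos hk).trans ?_).trans
      (le_add_of_nonneg_left ((norm_nonneg _).trans hG))
    gcongr

theorem IsRun.neg_lambdaMin_hessian_le [NeZero n] (hp : 2 ≤ p) (hm : 0 < m) (hσ₀ : 0 < σ₀)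
    (hθ₂ : 0 ≤ θ₂) (hf : ProblemAssumptions p f flow L κhigh κp)
    (hrun : IsRun m σ₀ θ₁ θ₂ f x₀ N x s σ T)
    (hpos : ∀ k < N, k % m = 0 → 0 < fdStep m s k)
    (hB : max 0 (-lambdaMin (hessian f x₀)) ≤ B) {k : ℕ} (hk : k ≤ N) (hσV : σ k ≤ V) :
    -lambdaMin (hessian f (x k)) ≤ B + (θ₂ * V + L) * pastStepsBound m σ₀ V ^ (p - 1) := by
  have hL := hf.lipschitzConst_nonneg
  have hV : 0 ≤ V := (hrun.σ_pos hσ₀ hk).le.trans hσV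
  have hW := pastStepsBound_nonneg (m := m) hσ₀ hV
  cases k with
  | zero =>
    rw [hrun.x_zero]
    exact ((le_max_right _ _).trans hB).trans (le_add_of_nonneg_right (by positivity))
  | succ j =>
    have hσj := (hrun.σ_mono hσ₀ j.le_succ hk).trans hσV
    have hWj := hrun.recentSteps_le_pastStepsBound hσ₀ hk hσV (j := j) (by omega)
    have hWj0 := recentSteps_nonneg (2 * m + 1) s j
    refine ((hrun.neg_lambdaMin_hessian_succ_le hp hm hσ₀ hθ₂ hf hpos hk).trans ?_).trans
      (le_add_of_nonneg_left ((le_max_left _ _).trans hB))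
    gcongr

theorem IsRun.norm_tensor_sub_le_of_σ_le [NeZero n] (hp : 2 ≤ p) (hm : 0 < m) (hσ₀ : 0 < σ₀)
    (hf : ProblemAssumptions p f flow L κhigh κp)
    (hrun : IsRun m σ₀ θ₁ θ₂ f x₀ N x s σ T)
    (hpos : ∀ k < N, k % m = 0 → 0 < fdStep m s k) {k : ℕ} (hk : k < N) (hσV : σ k ≤ V) :
    ‖T k - iteratedFDeriv ℝ p f (x k)‖ ≤ L * pastStepsBound m σ₀ V :=
  (hrun.norm_tensor_sub_le hp hm hf hpos hk).trans <| mul_le_mul_of_nonneg_left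
    ((recentSteps_mono s _ (Nat.le_succ _)).trans
      (hrun.recentSteps_le_pastStepsBound hσ₀ hk.le hσV (by omega))) hf.lipschitzConst_nonneg

theorem IsRun.norm_step_le_stepBound [NeZero n] (hp : 2 ≤ p) (hm : 0 < m) (hσ₀ : 0 < σ₀)
    (hθ₁ : 0 ≤ θ₁) (hθ₂ : 0 ≤ θ₂) (hf : ProblemAssumptions p f flow L κhigh κp)
    (hrun : IsRun m σ₀ θ₁ θ₂ f x₀ N x s σ T)
    (hpos : ∀ k < N, k % m = 0 → 0 < fdStep m s k) (hG : ‖gradient f x₀‖ ≤ G)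
    (hB : max 0 (-lambdaMin (hessian f x₀)) ≤ B) {k : ℕ} (hk : k < N) (hσV : σ k ≤ V) :
    ‖s k‖ ≤ stepBound p m σ₀ θ₁ θ₂ L κhigh κp G B V := by
  have hL := hf.lipschitzConst_nonneg
  have hB0 : 0 ≤ B := (le_max_left _ _).trans hB
  have hV : 0 ≤ V := (hrun.σ_pos hσ₀ hk.le).le.trans hσV
  have hW := pastStepsBound_nonneg (m := m) hσ₀ hV
  have hderiv := fun (i : ℕ) (hi : 1 ≤ i) (hip : i ≤ p) => hf.iteratedFDeriv_diagonal_ge hp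
    (hrun.norm_gradient_le hp hm hσ₀ hθ₁ hf hpos hG hk.le hσV)
    (hrun.neg_lambdaMin_hessian_le hp hm hσ₀ hθ₂ hf hpos hB hk.le hσV) (by positivity) (s k) hi hip
  refine (hrun.stepAccepted hk).norm_le (by omega) hσ₀ (hrun.le_σ hσ₀ hk.le)
    (coeffBound_nonneg hσ₀ hθ₁ hθ₂ hL ((norm_nonneg _).trans hG) hB0 hV) (fun i hi => ?_) ?_
  · obtain ⟨hi1, hip⟩ := Finset.mem_Icc.1 hi
    rw [derivOracle_eq f (x k) (by omega) (by omega)]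
    refine (neg_le_neg ?_).trans (hderiv i hi1 (by omega))
    gcongr
    exact le_add_of_nonneg_right (by positivity)
  · have herr := (abs_diagonal_le (T k - iteratedFDeriv ℝ p f (x k)) (s k)).trans
      (mul_le_mul_of_nonneg_right (hrun.norm_tensor_sub_le_of_σ_le hp hm hσ₀ hf hpos hk hσV)
        (by positivity))
    rw [_root_.sub_apply] at herr
    rw [coeffBound, add_mul]
    linarith [neg_le_of_abs_le herr, hderiv p (by omega) le_rfl]

theorem IsRun.σ_le_σMax [NeZero n] (hp : 2 ≤ p) (hm : 0 < m) (hσ₀ : 0 < σ₀)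
    (hθ₁ : 0 ≤ θ₁) (hθ₂ : 0 ≤ θ₂) (hf : ProblemAssumptions p f flow L κhigh κp)
    (hrun : IsRun m σ₀ θ₁ θ₂ f x₀ N x s σ T)
    (hpos : ∀ k < N, k % m = 0 → 0 < fdStep m s k) (hΔ : f x₀ - flow ≤ Δ)
    (hG : ‖gradient f x₀‖ ≤ G) (hB : max 0 (-lambdaMin (hessian f x₀)) ≤ B) :
    σ N ≤ σMax p m σ₀ θ₁ θ₂ L κhigh κp Δ G B := by
  have hC : 0 ≤ growthFactor p m L := growthFactor_nonneg hf.lipschitzConst_nonneg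
  have hr : 0 ≤ stepBound p m σ₀ θ₁ θ₂ L κhigh κp G B (2 * growthFactor p m L) :=
    stepBound_nonneg hσ₀ hθ₁ hθ₂ hf.lipschitzConst_nonneg ((norm_nonneg _).trans hG)
      ((le_max_left _ _).trans hB) (by positivity)
  have hstep : ∀ k < N, σ k ≤ 2 * growthFactor p m L → ‖s k‖ ^ (p + 1) ≤
      stepBound p m σ₀ θ₁ θ₂ L κhigh κp G B (2 * growthFactor p m L) ^ (p + 1) := by
    intro k hk hσk
    gcongr
    exact hrun.norm_step_le_stepBound hp hm hσ₀ hθ₁ hθ₂ hf hpos hG hB hk hσk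
  have hgrowth := hrun.σ_sub_le hp hm hf hpos hΔ
  rw [← hrun.σ_zero] at hgrowth
  have hbound := compound_le_of_growth_le (a := fun k => ‖s k‖ ^ (p + 1))
    (fun _ => by positivity) (hrun.σ_zero ▸ hσ₀) hrun.σ_succ hC (pow_nonneg hr _) hstep hgrowth
  rwa [hrun.σ_zero] at hbound

end RegularizationBound

section Complexity

/-- The number of iterations taken while `σ ≤ V`, before a stationary point is reached, is at most
this multiple of the rate. The first factor stems from the bounds on the gradient and the curvature
after a step, and the second one from the sum of the powers of the step lengths. -/
noncomputable def lengthFactor (p m : ℕ) (σ₀ θ₁ θ₂ L V : ℝ) : ℝ :=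
  (1 + (θ₁ + θ₂) * V + L) ^ 3
    * (((2 * m + 1 : ℕ) : ℝ) ^ (p + 1) * ((2 * m + 1 : ℕ) + V / σ₀))

/-- The constant of the iteration complexity bound. The absolute value makes it positive for all
parameters. -/
noncomputable def complexityConst (p m : ℕ) (σ₀ θ₁ θ₂ L κhigh κp Δ G B : ℝ) : ℝ :=
  1 + |lengthFactor p m σ₀ θ₁ θ₂ L (σMax p m σ₀ θ₁ θ₂ L κhigh κp Δ G B)|

theorem one_le_pow_mul_rpow_mul_pow {ε D W : ℝ} {b q r : ℕ} (hε : 0 < ε) (hD : 1 ≤ D)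
    (hW : 0 ≤ W) (hq : 0 < q) (hb : b ≤ r * q) (h : ε ≤ D * W ^ q) :
    1 ≤ D ^ r * ε ^ (-(b : ℝ) / q) * W ^ b := by
  have hq' : (0 : ℝ) < q := by exact_mod_cast hq
  have hbr : (b : ℝ) / q ≤ r := by
    rw [div_le_iff₀ hq']
    exact_mod_cast hb
  have hεpow : ε ^ ((b : ℝ) / q) ≤ D ^ r * W ^ b :=
    calc ε ^ ((b : ℝ) / q) ≤ (D * W ^ q) ^ ((b : ℝ) / q) :=
          Real.rpow_le_rpow hε.le h (by positivity)
      _ = D ^ ((b : ℝ) / q) * W ^ b := by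
          rw [Real.mul_rpow (by positivity) (by positivity), ← Real.rpow_natCast W q,
            ← Real.rpow_mul hW, mul_div_cancel₀ _ hq'.ne', Real.rpow_natCast]
      _ ≤ D ^ r * W ^ b := by
          rw [← Real.rpow_natCast D r]
          gcongr
  rw [neg_div, Real.rpow_neg hε.le, mul_right_comm, ← div_eq_mul_inv,
    one_le_div (Real.rpow_pos_of_pos hε _)]
  exact hεpow

theorem one_le_rate {p : ℕ} {ε₁ ε₂ : ℝ} (hp : 0 < p) (h₁ : 0 < ε₁) (h₂ : 0 < ε₂)
    (h : ε₁ ≤ 1 ∨ ε₂ ≤ 1) : 1 ≤ rate p ε₁ ε₂ := by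
  have hp' : (1 : ℝ) ≤ p := by exact_mod_cast hp
  rcases h with h | h
  · exact le_max_of_le_left (Real.one_le_rpow_of_pos_of_le_one_of_nonpos h₁ h
      (div_nonpos_of_nonpos_of_nonneg (by linarith) (by linarith)))
  · exact le_max_of_le_right (Real.one_le_rpow_of_pos_of_le_one_of_nonpos h₂ h
      (div_nonpos_of_nonpos_of_nonneg (by linarith) (by linarith)))

variable {n p m N : ℕ} {σ₀ θ₁ θ₂ flow L κhigh κp Δ G B V ε₁ ε₂ : ℝ} {f : E n → ℝ} {x₀ : E n}
  {x s : ℕ → E n} {σ : ℕ → ℝ} {T : ℕ → Tensor n p}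

theorem one_le_rate_mul_pow {D W : ℝ} {y : E n} (hp : 2 ≤ p) (hε₁ : 0 < ε₁) (hε₂ : 0 < ε₂)
    (hD : 1 ≤ D) (hW : 0 ≤ W) (hgrad : ‖gradient f y‖ ≤ D * W ^ p)
    (hcurv : -lambdaMin (hessian f y) ≤ D * W ^ (p - 1))
    (hstat : ¬ SecondOrderStationary f ε₁ ε₂ y) :
    1 ≤ D ^ 3 * rate p ε₁ ε₂ * W ^ (p + 1) := by
  rw [SecondOrderStationary, not_and_or, not_le, not_le] at hstat
  rcases hstat with h | h
  · have hbig := one_le_pow_mul_rpow_mul_pow (b := p + 1) (r := 3) hε₁ hD hW (by omega) (by omega)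
      (h.le.trans hgrad)
    refine hbig.trans ?_
    push_cast
    gcongr
    exact le_max_left _ _
  · have hbig := one_le_pow_mul_rpow_mul_pow (b := p + 1) (r := 3) hε₂ hD hW (by omega) (by omega)
      ((lt_neg.1 h).le.trans hcurv)
    refine hbig.trans ?_
    rw [Nat.cast_sub (by omega)]
    push_cast
    gcongr
    exact le_max_right _ _

theorem IsRun.one_le_rate_mul_recentSteps_pow [NeZero n] (hp : 2 ≤ p) (hm : 0 < m) (hσ₀ : 0 < σ₀)
    (hθ₁ : 0 ≤ θ₁) (hθ₂ : 0 ≤ θ₂) (hf : ProblemAssumptions p f flow L κhigh κp)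
    (hrun : IsRun m σ₀ θ₁ θ₂ f x₀ N x s σ T)
    (hpos : ∀ k < N, k % m = 0 → 0 < fdStep m s k) (hε₁ : 0 < ε₁) (hε₂ : 0 < ε₂)
    {k : ℕ} (hk : k < N) (hσV : σ k ≤ V)
    (hstat : ¬ SecondOrderStationary f ε₁ ε₂ (x (k + 1))) :
    1 ≤ (1 + (θ₁ + θ₂) * V + L) ^ 3 * rate p ε₁ ε₂ * recentSteps (2 * m + 1) s k ^ (p + 1) := by
  have hL := hf.lipschitzConst_nonneg
  have hV : 0 ≤ V := (hrun.σ_pos hσ₀ hk.le).le.trans hσV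
  have hW := recentSteps_nonneg (2 * m + 1) s k
  have hθ₁V : θ₁ * σ k ≤ θ₁ * V := by gcongr
  have hθ₂V : θ₂ * σ k ≤ θ₂ * V := by gcongr
  have hθ₁V0 : 0 ≤ θ₁ * V := by positivity
  have hθ₂V0 : 0 ≤ θ₂ * V := by positivity
  refine one_le_rate_mul_pow hp hε₁ hε₂ (by linarith) hW
    ((hrun.norm_gradient_succ_le hp hm hσ₀ hθ₁ hf hpos hk).trans ?_)
    ((hrun.neg_lambdaMin_hessian_succ_le hp hm hσ₀ hθ₂ hf hpos hk).trans ?_) hstat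
  all_goals
    gcongr
    linarith

theorem IsRun.length_le [NeZero n] (hp : 2 ≤ p) (hm : 0 < m) (hσ₀ : 0 < σ₀)
    (hθ₁ : 0 ≤ θ₁) (hθ₂ : 0 ≤ θ₂) (hf : ProblemAssumptions p f flow L κhigh κp)
    (hrun : IsRun m σ₀ θ₁ θ₂ f x₀ N x s σ T)
    (hpos : ∀ k < N, k % m = 0 → 0 < fdStep m s k) (hε₁ : 0 < ε₁) (hε₂ : 0 < ε₂)
    (hσV : σ N ≤ V) (hstat : ∀ k < N, ¬ SecondOrderStationary f ε₁ ε₂ (x (k + 1))) :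
    (N : ℝ) ≤ lengthFactor p m σ₀ θ₁ θ₂ L V * rate p ε₁ ε₂ := by
  have hL := hf.lipschitzConst_nonneg
  have hV : 0 ≤ V := (hrun.σ_pos hσ₀ le_rfl).le.trans hσV
  have hrate : 0 ≤ rate p ε₁ ε₂ := le_max_of_le_left (Real.rpow_nonneg hε₁.le _)
  have hterm : ∀ k < N, 1 ≤ (1 + (θ₁ + θ₂) * V + L) ^ 3 * rate p ε₁ ε₂
      * recentSteps (2 * m + 1) s k ^ (p + 1) := fun k hk =>
    hrun.one_le_rate_mul_recentSteps_pow hp hm hσ₀ hθ₁ hθ₂ hf hpos hε₁ hε₂ hk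
      ((hrun.σ_mono hσ₀ hk.le le_rfl).trans hσV) (hstat k hk)
  calc (N : ℝ) = ∑ _k ∈ Finset.range N, (1 : ℝ) := by simp
    _ ≤ ∑ k ∈ Finset.range N, (1 + (θ₁ + θ₂) * V + L) ^ 3 * rate p ε₁ ε₂
          * recentSteps (2 * m + 1) s k ^ (p + 1) :=
        Finset.sum_le_sum fun k hk => hterm k (Finset.mem_range.1 hk)
    _ = (1 + (θ₁ + θ₂) * V + L) ^ 3 * rate p ε₁ ε₂
          * ∑ k ∈ Finset.range N, recentSteps (2 * m + 1) s k ^ (p + 1) := by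
        rw [Finset.mul_sum]
    _ ≤ (1 + (θ₁ + θ₂) * V + L) ^ 3 * rate p ε₁ ε₂
          * (((2 * m + 1 : ℕ) : ℝ) ^ (p + 1) * ((2 * m + 1 : ℕ) + V / σ₀)) := by
        gcongr
        refine (sum_recentSteps_pow_le _ p s N).trans ?_
        gcongr
        exact (hrun.sum_norm_pow_le hσ₀ le_rfl).trans (by gcongr)
    _ = lengthFactor p m σ₀ θ₁ θ₂ L V * rate p ε₁ ε₂ := by
        rw [lengthFactor]
        ring

theorem IsRun.exists_secondOrderStationary [NeZero n] (hp : 2 ≤ p) (hm : 0 < m) (hσ₀ : 0 < σ₀)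
    (hθ₁ : 0 ≤ θ₁) (hθ₂ : 0 ≤ θ₂) (hf : ProblemAssumptions p f flow L κhigh κp)
    (hrun : IsRun m σ₀ θ₁ θ₂ f x₀ N x s σ T) (hΔ : f x₀ - flow ≤ Δ) (hG : ‖gradient f x₀‖ ≤ G)
    (hB : max 0 (-lambdaMin (hessian f x₀)) ≤ B) (hε₁ : 0 < ε₁) (hε₂ : 0 < ε₂)
    (hN : lengthFactor p m σ₀ θ₁ θ₂ L (σMax p m σ₀ θ₁ θ₂ L κhigh κp Δ G B) * rate p ε₁ ε₂ < N) :
    ∃ j ≤ N, SecondOrderStationary f ε₁ ε₂ (x j) := by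
  by_contra! hstat
  have hpos : ∀ k < N, k % m = 0 → 0 < fdStep m s k := fun k hk hkm =>
    (hrun.fdStep_pos k hk hkm).resolve_right fun h =>
      hstat k hk.le ⟨h.1.trans hε₁.le, (neg_le_neg hε₂.le).trans h.2⟩
  exact hN.not_ge (hrun.length_le hp hm hσ₀ hθ₁ hθ₂ hf hpos hε₁ hε₂
    (hrun.σ_le_σMax hp hm hσ₀ hθ₁ hθ₂ hf hpos hΔ hG hB) fun k hk => hstat (k + 1) hk)

theorem one_le_complexityConst : 1 ≤ complexityConst p m σ₀ θ₁ θ₂ L κhigh κp Δ G B :=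
  le_add_of_nonneg_right (abs_nonneg _)

theorem lengthFactor_mul_rate_lt_floor (hrate : 1 ≤ rate p ε₁ ε₂) :
    lengthFactor p m σ₀ θ₁ θ₂ L (σMax p m σ₀ θ₁ θ₂ L κhigh κp Δ G B) * rate p ε₁ ε₂
      < ⌊complexityConst p m σ₀ θ₁ θ₂ L κhigh κp Δ G B * rate p ε₁ ε₂⌋₊ := by
  have hfloor := Nat.lt_floor_add_one
    (complexityConst p m σ₀ θ₁ θ₂ L κhigh κp Δ G B * rate p ε₁ ε₂)
  have habs := mul_le_mul_of_nonneg_right (le_abs_self (lengthFactor p m σ₀ θ₁ θ₂ L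
    (σMax p m σ₀ θ₁ θ₂ L κhigh κp Δ G B))) (zero_le_one.trans hrate)
  rw [complexityConst, add_mul, one_mul] at hfloor
  rw [complexityConst, add_mul, one_mul]
  linarith

theorem evaluations_succ_le [NeZero n] {R : ℝ} (hR : 1 ≤ R) {j : ℕ} (hj : (j : ℝ) ≤ R) :
    (evaluations m f x s T (j + 1) : ℝ) ≤ 4 * (n * R) := by
  have hn : (1 : ℝ) ≤ n := by exact_mod_cast NeZero.one_le
  calc (evaluations m f x s T (j + 1) : ℝ) ≤ (n + 1) * (j + 1) := by
        exact_mod_cast evaluations_le m f x s T (j + 1)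
    _ ≤ (n + n) * (R + R) := by gcongr
    _ = 4 * (n * R) := by ring

end Complexity

end ARpFD


open ARpFD in
theorem mainTheorem2_general (p m : ℕ) (hp : 2 ≤ p) (hm : 1 ≤ m)
    (σ₀ θ₁ θ₂ : ℝ) (hσ₀ : 0 < σ₀) (hθ₁ : 0 ≤ θ₁) (hθ₂ : 0 ≤ θ₂) (L κhigh κp Δ G B : ℝ) :
    ∃ C : ℝ, 0 < C ∧
      ∀ (n : ℕ), 1 ≤ n →
      ∀ (f : E n → ℝ) (flow : ℝ) (x₀ : E n),
        ProblemAssumptions p f flow L κhigh κp →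
        f x₀ - flow ≤ Δ → ‖gradient f x₀‖ ≤ G →
        max 0 (-lambdaMin (hessian f x₀)) ≤ B →
      ∀ (ε₁ ε₂ : ℝ), 0 < ε₁ → 0 < ε₂ → ε₁ ≤ 1 ∨ ε₂ ≤ 1 →
      ∀ (N : ℕ) (x s : ℕ → E n) (σ : ℕ → ℝ) (T : ℕ → Tensor n p),
        IsRun m σ₀ θ₁ θ₂ f x₀ N x s σ T →
        C * rate p ε₁ ε₂ ≤ (N : ℝ) →
        ∃ j ≤ N,
          (j : ℝ) ≤ C * rate p ε₁ ε₂ ∧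
          (evaluations m f x s T (j + 1) : ℝ) ≤ C * ((n : ℝ) * rate p ε₁ ε₂) ∧
          SecondOrderStationary f ε₁ ε₂ (x j) := by
  let c := complexityConst p m σ₀ θ₁ θ₂ L κhigh κp Δ G B
  have hc : 1 ≤ c := one_le_complexityConst
  refine ⟨4 * c, by positivity, ?_⟩
  intro n hn f flow x₀ hf hΔ hG hB ε₁ ε₂ hε₁ hε₂ hε N x s σ T hrun hN
  have : NeZero n := ⟨by omega⟩
  have hrate := one_le_rate (p := p) (by omega) hε₁ hε₂ hε
  have hR : 1 ≤ c * rate p ε₁ ε₂ := one_le_mul_of_one_le_of_one_le hc hrate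
  have hK : ⌊c * rate p ε₁ ε₂⌋₊ ≤ N := Nat.floor_le_of_le (by linarith)
  obtain ⟨j, hjK, hj⟩ := (hrun.of_le hK).exists_secondOrderStationary hp hm hσ₀ hθ₁ hθ₂ hf
    hΔ hG hB hε₁ hε₂ (lengthFactor_mul_rate_lt_floor hrate)
  have hjR : (j : ℝ) ≤ c * rate p ε₁ ε₂ := (Nat.le_floor_iff (by positivity)).1 hjK
  refine ⟨j, hjK.trans hK, by linarith, ?_, hj⟩
  exact (evaluations_succ_le hR hjR).trans_eq (by ring)

/-- The constant `C` depends on the parameters of the algorithm, on the constants of the assumptions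
and on upper bounds `Δ, G, B` for the initial gap, gradient norm and negative curvature, but not on
the dimension, the function, the accuracies or the run. -/
theorem mainTheorem2 (p m : ℕ) (hp : 2 ≤ p) (hm : 1 ≤ m)
    (σ₀ θ₁ θ₂ : ℝ) (hσ₀ : 0 < σ₀) (hθ₁ : 1 < θ₁) (hθ₂ : 1 < θ₂)
    (L κhigh κp : ℝ) (hL : 3 ≤ L) (hκhigh : 0 ≤ κhigh) (Δ G B : ℝ) :
    ∃ C : ℝ, 0 < C ∧
      ∀ (n : ℕ), 1 ≤ n →
      ∀ (f : ARpFD.E n → ℝ) (flow : ℝ) (x₀ : ARpFD.E n),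
        ARpFD.ProblemAssumptions p f flow L κhigh κp →
        f x₀ - flow ≤ Δ → ‖gradient f x₀‖ ≤ G →
        max 0 (-ARpFD.lambdaMin (ARpFD.hessian f x₀)) ≤ B →
      ∀ (ε₁ ε₂ : ℝ), 0 < ε₁ → ε₁ ≤ 1 → 0 < ε₂ → ε₂ ≤ 1 →
      ∀ (N : ℕ) (x s : ℕ → ARpFD.E n) (σ : ℕ → ℝ) (T : ℕ → ARpFD.Tensor n p),
        ARpFD.IsRun m σ₀ θ₁ θ₂ f x₀ N x s σ T →
        C * ARpFD.rate p ε₁ ε₂ ≤ (N : ℝ) →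
        ∃ j ≤ N,
          (j : ℝ) ≤ C * ARpFD.rate p ε₁ ε₂ ∧
          (ARpFD.evaluations m f x s T (j + 1) : ℝ) ≤ C * ((n : ℝ) * ARpFD.rate p ε₁ ε₂) ∧
          ARpFD.SecondOrderStationary f ε₁ ε₂ (x j) := by
  obtain ⟨C, hC, h⟩ := mainTheorem2_general p m hp hm σ₀ θ₁ θ₂ hσ₀ (by linarith) (by linarith)
    L κhigh κp Δ G B
  exact ⟨C, hC, fun n hn f flow x₀ hf hΔ hG hB ε₁ ε₂ hε₁ hε₁' hε₂ _ =>
    h n hn f flow x₀ hf hΔ hG hB ε₁ ε₂ hε₁ hε₂ (Or.inl hε₁')⟩
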